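/- All graphs here have a fixed finite vertex set $V$, no loops, and at most one edge between two vertices; an edge is either an arrow $a\to b$ or a line $a-b$. A *semi-directed cycle* is a sequence $(v_0,\dots,v_k)$ with $k\ge 3$, $v_0=v_k$, $v_0,\dots,v_{k-1}$ distinct, such that for each $i=1,\dots,k$ the graph contains $v_{i-1}\to v_i$ or $v_{i-1}-v_i$, with $v_{i-1}\to v_i$ for at least one $i$. A graph is *adicyclic*, or a *chain graph*, if it has no semi-directed cycle. A *triplex* $(\{a,c\},b)$ is an induced subgraph $a\to b\leftarrow c$, $a\to b-c$ or $a-b\leftarrow c$; a *2-biflag* $[a,b;c,d]$ is a subgraph $a\to c-d\leftarrow b$ in which $a,d$ are not adjacent and $b,c$ are not adjacent. The *augmented graph* $G^a$ is the undirected graph obtained from $G$ by replacing all arrows by lines, joining $a$ and $c$ for each triplex $(\{a,c\},b)$, and joining $a$ and $b$ for each 2-biflag $[a,b;c,d]$. For $S\subseteq V$ let $\mathrm{An}(S)$ be the set of vertices with a directed path of length $\ge 0$ to a vertex of $S$, let $\mathrm{Co}(S)$ be the set of vertices joined to a vertex of $S$ by a path of lines of length $\ge 0$, and let $G[S]$ consist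 of the subgraph of $G$ induced by $\mathrm{An}(S)$ together with all lines of $G$ between vertices of $\mathrm{Co}(\mathrm{An}(S))$. A probability distribution $P$ on a product $\prod_{v\in V}X_v$ of standard Borel spaces is *AMP (Andersson–Madigan–Perlman) Markov* with respect to $G$ if $X_A\perp\!\!\!\perp X_B\mid X_C$ under $P$ for all pairwise disjoint $A,B,C\subseteq V$ such that $C$ separates $A$ from $B$ in $(G[A\cup B\cup C])^a$. Let $\mathcal P(G)$ be the set of these distributions. Two graphs $G,H$ are *(AMP) Markov equivalent* if $\mathcal P(G)=\mathcal P(H)$ on every such product space. The *AMP Markov equivalence class* of a chain graph $G_0$ is the set of all chain graphs that are Markov equivalent to $G_0$. For an AMP Markov equivalence class $\mathcal G$, the *AMP essential graph* $\mathcal G^*$ is the graph on $V$ that contains the arrow $a\to b$ iff $a\to b$ occurs in some $G\in\mathcal G$ and $a\leftarrow b$ occurs in no $G\in\mathcal G$, and contains the line $a-b$ iff either $a-b$ occurs in every $G\in\mathcal G$, or $a\to b$ occurs in some $G\in\mathcal G$ and $a\leftarrow b$ occurs in some $G'\in\mathcal G$. **Theorem 3.2.** For every AMP Markov equivalence class $\mathcal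 G$ of chain graphs on $V$, the essential graph $\mathcal G^*$ has the same skeleton as (i.e. the same pairs of adjacent vertices as) each $G\in\mathcal G$, is adicyclic (i.e. is a chain graph), and belongs to $\mathcal G$; so it is Markov equivalent to every $G\in\mathcal G$. Consequently $\mathcal G^*$ uniquely represents $\mathcal G$: for AMP Markov equivalence classes $\mathcal G_1,\mathcal G_2$ of chain graphs on $V$, $\mathcal G_1=\mathcal G_2$ if and only if $\mathcal G_1^*=\mathcal G_2^*$. -/

import Mathlib

open MeasureTheory ProbabilityTheory

/-- A graph with directed and undirected edges, at most one edge between two vertices and no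
loops, coded by its edge set `E ⊆ {(a, b) | a ≠ b}`: the pair `(a, b)` alone is an arrow `a → b`,
and both pairs `(a, b)`, `(b, a)` together are a line `a - b`. Thus `Edge a b` says
"`a → b` or `a - b`". -/
@[ext]
structure MixedGraph (V : Type*) where
  Edge : V → V → Prop
  irrefl : ∀ a, ¬ Edge a a

namespace MixedGraph

variable {V : Type*}

/-- `a → b`. -/
def Arrow (G : MixedGraph V) (a b : V) : Prop := G.Edge a b ∧ ¬ G.Edge b a

/-- `a - b`. -/
def Line (G : MixedGraph V) (a b : V) : Prop := G.Edge a b ∧ G.Edge b a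

/-- `a` and `b` are joined by an arrow (of either orientation) or a line. -/
def Adj (G : MixedGraph V) (a b : V) : Prop := G.Edge a b ∨ G.Edge b a

def SameSkeleton (G H : MixedGraph V) : Prop := ∀ a b, G.Adj a b ↔ H.Adj a b

/-- `(v 0, …, v k)` is a semi-directed cycle: `k ≥ 3`, `v 0 = v k`, the vertices
`v 0, …, v (k - 1)` are distinct, each step is an arrow forward or a line, and at least one step
is an arrow. -/
def IsSemidirectedCycle (G : MixedGraph V) (k : ℕ) (v : ℕ → V) : Prop :=
  3 ≤ k ∧ v 0 = v k ∧ Set.InjOn v (Set.Iio k) ∧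
    (∀ i < k, G.Edge (v i) (v (i + 1))) ∧ ∃ i < k, G.Arrow (v i) (v (i + 1))

/-- A chain graph, i.e. an adicyclic graph: one without semi-directed cycles. -/
def IsChainGraph (G : MixedGraph V) : Prop := ∀ k v, ¬ G.IsSemidirectedCycle k v

/-- The triplex `({a, c}, b)`: one of `a → b ← c`, `a → b - c`, `a - b ← c` is an induced
subgraph. -/
def Triplex (G : MixedGraph V) (a b c : V) : Prop :=
  a ≠ c ∧ ¬ G.Adj a c ∧ G.Edge a b ∧ G.Edge c b ∧ (G.Arrow a b ∨ G.Arrow c b)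

/-- The 2-biflag `[a, b; c, d]`: `a → c - d ← b`, with `a, d` not adjacent and `b, c` not
adjacent; `a` and `b` may or may not be adjacent. -/
def Biflag (G : MixedGraph V) (a b c d : V) : Prop :=
  G.Arrow a c ∧ G.Line c d ∧ G.Arrow b d ∧ ¬ G.Adj a d ∧ ¬ G.Adj b c

/-- The augmented graph `G^a`: all arrows become lines, and each triplex `({a, c}, b)` and each
2-biflag `[a, b; c, d]` is made complete. -/
def augmented (G : MixedGraph V) : SimpleGraph V :=
  SimpleGraph.fromRel fun a b =>
    G.Adj a b ∨ (∃ c, G.Triplex a c b) ∨ ∃ c d, G.Biflag a b c d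

/-- `An(A)`: the vertices with a directed path (of length `≥ 0`) into `A`. -/
def ancestors (G : MixedGraph V) (A : Set V) : Set V :=
  {v | ∃ a ∈ A, Relation.ReflTransGen G.Arrow v a}

/-- `Co(A)`: the union of the chain components that meet `A`. -/
def coherent (G : MixedGraph V) (A : Set V) : Set V :=
  {v | ∃ a ∈ A, Relation.ReflTransGen G.Line v a}

/-- The extended subgraph `G[A]`: the subgraph induced on `An(A)`, together with all lines
within `Co(An(A))`. (Vertices outside `Co(An(A))` are kept, as isolated vertices.) -/
def extended (G : MixedGraph V) (A : Set V) : MixedGraph V where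
  Edge a b :=
    (G.Edge a b ∧ a ∈ G.ancestors A ∧ b ∈ G.ancestors A) ∨
      (G.Line a b ∧ a ∈ G.coherent (G.ancestors A) ∧ b ∈ G.coherent (G.ancestors A))
  irrefl a := by
    rintro (⟨h, -⟩ | ⟨⟨h, -⟩, -⟩) <;> exact G.irrefl a h

/-- `C` separates `A` from `B` in the undirected graph `U`. -/
def Separates (U : SimpleGraph V) (A B C : Set V) : Prop :=
  ∀ a ∈ A, ∀ b ∈ B, ∀ p : U.Walk a b, ∃ c ∈ C, c ∈ p.support

/-- `X_A ⫫ X_B | X_C` under `P`, for the coordinate maps on a product space. -/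
def CondIndepCoord [Finite V] {X : V → Type} [∀ v, MeasurableSpace (X v)]
    [∀ v, StandardBorelSpace (X v)] (P : ProbabilityMeasure (∀ v, X v)) (A B C : Set V) : Prop :=
  CondIndepFun (MeasurableSpace.comap (C.domRestrict (π := X)) inferInstance)
    (Set.measurable_restrict C).comap_le (A.domRestrict (π := X)) (B.domRestrict (π := X))
    (P : Measure (∀ v, X v))

/-- `𝒫(G)` on the product space `∏ v, X v`: the probability distributions with the (global)
Andersson–Madigan–Perlman Markov property of `G`, i.e. `X_A ⫫ X_B | X_C` whenever `C` separates
`A` from `B` in the augmented graph of the extended subgraph `G[A ∪ B ∪ C]`. -/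
def ampModel [Finite V] (G : MixedGraph V) (X : V → Type) [∀ v, MeasurableSpace (X v)]
    [∀ v, StandardBorelSpace (X v)] : Set (ProbabilityMeasure (∀ v, X v)) :=
  {P | ∀ A B C : Set V, Disjoint A B → Disjoint A C → Disjoint B C →
    Separates (G.extended (A ∪ B ∪ C)).augmented A B C → CondIndepCoord P A B C}

/-- AMP Markov equivalence: `𝒫(G) = 𝒫(H)`, on every product of standard Borel spaces. -/
def MarkovEquiv [Finite V] (G H : MixedGraph V) : Prop :=
  ∀ (X : V → Type) [∀ v, MeasurableSpace (X v)] [∀ v, StandardBorelSpace (X v)],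
    G.ampModel X = H.ampModel X

/-- `𝒢` is the AMP Markov equivalence class of some chain graph. -/
def IsMarkovClass [Finite V] (𝒢 : Set (MixedGraph V)) : Prop :=
  ∃ G₀ : MixedGraph V, G₀.IsChainGraph ∧ 𝒢 = {G | G.IsChainGraph ∧ MarkovEquiv G G₀}

/-- `a → b` occurs in some member of `𝒢`, and `a ← b` in none. -/
def EssentialArrow (𝒢 : Set (MixedGraph V)) (a b : V) : Prop :=
  (∃ G ∈ 𝒢, G.Arrow a b) ∧ ∀ G ∈ 𝒢, ¬ G.Arrow b a

/-- `a - b` occurs in every member of `𝒢`, or `a → b` and `a ← b` both occur in members. -/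
def EssentialLine (𝒢 : Set (MixedGraph V)) (a b : V) : Prop :=
  (∀ G ∈ 𝒢, G.Line a b) ∨ ((∃ G ∈ 𝒢, G.Arrow a b) ∧ ∃ G ∈ 𝒢, G.Arrow b a)

/-- The AMP essential graph `𝒢*`. The clause `a ≠ b` matters only for empty `𝒢`. -/
def essentialGraph (𝒢 : Set (MixedGraph V)) : MixedGraph V where
  Edge a b := a ≠ b ∧ (EssentialArrow 𝒢 a b ∨ EssentialLine 𝒢 a b)
  irrefl _ h := h.1 rfl

theorem EssentialLine.symm {𝒢 : Set (MixedGraph V)} {a b : V} (h : EssentialLine 𝒢 a b) :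
    EssentialLine 𝒢 b a :=
  h.imp (fun h G hG => (h G hG).symm) And.symm

/-- The arrows of `𝒢*` are the essential arrows. -/
theorem essentialGraph_arrow (𝒢 : Set (MixedGraph V)) (a b : V) :
    (essentialGraph 𝒢).Arrow a b ↔ EssentialArrow 𝒢 a b := by
  constructor
  · rintro ⟨⟨hne, h | h⟩, h'⟩
    · exact h
    · exact absurd ⟨hne.symm, Or.inr h.symm⟩ h'
  · rintro ⟨⟨G, hG, hab⟩, h⟩
    refine ⟨⟨?_, Or.inl ⟨⟨G, hG, hab⟩, h⟩⟩, ?_⟩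
    · rintro rfl
      exact hab.2 hab.1
    · rintro ⟨-, h' | h' | h'⟩
      · exact h'.2 G hG hab
      · exact hab.2 (h' G hG).1
      · obtain ⟨⟨G', hG', h''⟩, -⟩ := h'
        exact h G' hG' h''

/-- The lines of `𝒢*` are the essential lines. -/
theorem essentialGraph_line {𝒢 : Set (MixedGraph V)} (h𝒢 : 𝒢.Nonempty) (a b : V) :
    (essentialGraph 𝒢).Line a b ↔ EssentialLine 𝒢 a b := by
  constructor
  · rintro ⟨⟨-, h | h⟩, h'⟩
    · exact absurd h' ((essentialGraph_arrow 𝒢 a b).2 h).2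
    · exact h
  · intro h
    have hne : a ≠ b := by
      rintro rfl
      obtain ⟨G, hG⟩ := h𝒢
      rcases h with h | ⟨⟨G', -, h⟩, -⟩
      · exact G.irrefl a (h G hG).1
      · exact h.2 h.1
    exact ⟨⟨hne, Or.inr h⟩, ⟨hne.symm, Or.inr h.symm⟩⟩

end MixedGraph

/-!
Markov equivalence of chain graphs amounts to having the same skeleton and the same triplexes.
Two-point distributions (one fair coin shared by suitable vertices) detect both. Conversely,
separation in the augmented graphs is the absence of open routes, and the open routes are the same
after two local moves that keep the triplexes: reversing a covered arrow, one whose ends lie on no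
lines and have the same further parents, and splitting a chain component by turning the lines
between two parts of it into arrows. Splitting leads from any member of a class to a member whose
lines are lines in every member, and two members of this kind differ by reversals of covered arrows.

The essential graph then belongs to its class as soon as it has no semi-directed cycle, for its
skeleton and triplexes are read off the members. A shortest semi-directed cycle in it is a triangle
`x → y — z — x`, because the triplexes and chain-graph property of a single member exclude a longer
one. In a triangle with a fixed arrow and two reversible edges, a descent through the reversals of
covered arrows gives a contradiction.
-/

theorem condIndepFun_of_ae_eq_measurable_left {Ω β γ : Type*} {m' mΩ : MeasurableSpace Ω}
    [StandardBorelSpace Ω] {hm' : m' ≤ mΩ} {μ : Measure Ω} [IsFiniteMeasure μ]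
    [MeasurableSpace β] [MeasurableSpace γ] {f h : Ω → β} {g : Ω → γ} (hf : Measurable f)
    (hg : Measurable g) (hh : Measurable[m'] h) (hfh : f =ᵐ[μ] h) : CondIndepFun m' hm' f g μ := by
  have indep : CondIndepFun m' hm' h g μ := condIndepFun_of_measurable_left hh hg
  rw [condIndepFun_iff_condExp_inter_preimage_eq_mul (hh.mono hm' le_rfl) hg] at indep
  rw [condIndepFun_iff_condExp_inter_preimage_eq_mul hf hg]
  intro s t hs ht
  have preimage_ae_eq : f ⁻¹' s =ᵐ[μ] h ⁻¹' s := by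
    filter_upwards [hfh] with x hx
    exact congrArg (· ∈ s) hx
  have inter_ae_eq := preimage_ae_eq.inter (ae_eq_refl (g ⁻¹' t))
  have condExp_ae_eq {s t : Set Ω} (hst : s =ᵐ[μ] t) : μ⟦s | m'⟧ =ᵐ[μ] μ⟦t | m'⟧ :=
    condExp_congr_ae (indicator_ae_eq_of_ae_eq_set hst)
  filter_upwards [indep s t hs ht, condExp_ae_eq preimage_ae_eq, condExp_ae_eq inter_ae_eq]
    with x hx hpre hinter
  rw [hinter, hx, hpre]

namespace MixedGraph

variable {V : Type*} {G H K G₀ D E : MixedGraph V} {a b c p q v w x y z m r : V} {T : Set V}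

theorem Edge.ne (h : G.Edge a b) : a ≠ b := by
  rintro rfl
  exact G.irrefl a h

theorem Adj.symm (h : G.Adj a b) : G.Adj b a := Or.symm h

theorem Adj.ne (h : G.Adj a b) : a ≠ b := h.elim Edge.ne fun h => h.ne.symm

theorem Line.symm (h : G.Line a b) : G.Line b a := And.symm h

theorem Line.adj (h : G.Line a b) : G.Adj a b := Or.inl h.1

theorem Arrow.adj (h : G.Arrow a b) : G.Adj a b := Or.inl h.1

theorem adj_iff_arrow_or_line : G.Adj a b ↔ G.Arrow a b ∨ G.Line a b ∨ G.Arrow b a := by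
  unfold Adj Arrow Line
  tauto

theorem Adj.arrow_of_not_edge (h : G.Adj a b) (hn : ¬ G.Edge b a) : G.Arrow a b :=
  ⟨h.resolve_right hn, hn⟩

/-- `b` can be reached from `a` along lines and along arrows in their direction. -/
def Reach (G : MixedGraph V) : V → V → Prop := Relation.ReflTransGen G.Edge

theorem Reach.refl (a : V) : G.Reach a a := Relation.ReflTransGen.refl

theorem Reach.trans (h : G.Reach a b) (h' : G.Reach b c) : G.Reach a c :=
  Relation.ReflTransGen.trans h h'

theorem Edge.reach (h : G.Edge a b) : G.Reach a b := Relation.ReflTransGen.single h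

theorem Reach.mono (hle : ∀ a b, G.Edge a b → H.Edge a b) (h : G.Reach a b) : H.Reach a b :=
  Relation.ReflTransGen.mono hle _ _ h

/-! ### Shortest walks and chain graphs -/

section Walks

variable {r : V → V → Prop} {k i j : ℕ} {v : ℕ → V}

/-- `v 0, …, v k` is a walk of the relation `r`. -/
def IsWalk (r : V → V → Prop) (k : ℕ) (v : ℕ → V) : Prop := ∀ i < k, r (v i) (v (i + 1))

theorem exists_isWalk (h : Relation.ReflTransGen r a b) :
    ∃ k v, IsWalk r k v ∧ v 0 = a ∧ v k = b := by
  induction h using Relation.ReflTransGen.head_induction_on with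
  | refl => exact ⟨0, fun _ => b, by simp [IsWalk], rfl, rfl⟩
  | @head a c hac _ ih =>
    obtain ⟨k, v, hv, rfl, hk⟩ := ih
    refine ⟨k + 1, fun i => Nat.casesOn i a v, ?_, rfl, hk⟩
    rintro (_ | i) hi
    · exact hac
    · exact hv i (by omega)

theorem IsWalk.reflTransGen (h : IsWalk r k v) (hij : i ≤ j) (hj : j ≤ k) :
    Relation.ReflTransGen r (v i) (v j) := by
  induction j, hij using Nat.le_induction with
  | base => exact .refl
  | succ j _ ih => exact (ih (by omega)).tail (h j (by omega))

theorem IsWalk.shift (h : IsWalk r k v) (hj : j ≤ k) :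
    IsWalk r (j - i) fun l => v (i + l) :=
  fun l hl => h (i + l) (by omega)

theorem IsWalk.splice (h : IsWalk r k v) (s : ℕ) (hi : i + s + 1 ≤ k)
    (hr : r (v i) (v (i + s + 1))) :
    IsWalk r (k - s) fun l => if l ≤ i then v l else v (l + s) := by
  intro l hl
  rcases lt_trichotomy l i with hli | rfl | hli
  · simpa [hli.le, show l + 1 ≤ i by omega] using h l (by omega)
  · simpa [add_right_comm] using hr
  · simpa [show ¬ l ≤ i by omega, show ¬ l + 1 ≤ i by omega, add_right_comm] using
      h (l + s) (by omega)

/-- A walk without shortcuts: no repeated vertices and no forward chords. -/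
structure IsGeodesic (r : V → V → Prop) (k : ℕ) (v : ℕ → V) : Prop where
  isWalk : IsWalk r k v
  chordless : ∀ {i j}, i < j → j ≤ k → r (v i) (v j) → j = i + 1
  inj : ∀ {i j}, i ≤ k → j ≤ k → v i = v j → i = j

theorem IsWalk.isGeodesic_of_minimal (h : IsWalk r k v)
    (hmin : ∀ m < k, ∀ w, IsWalk r m w → w 0 = v 0 → w m ≠ v k) : IsGeodesic r k v := by
  have no_repeat : ∀ {i j}, i < j → j ≤ k → v i ≠ v j := by
    intro i j hij hj heq
    rcases hj.eq_or_lt with rfl | hj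
    · exact hmin i hij v (fun l hl => h l (by omega)) rfl heq
    · obtain ⟨s, rfl⟩ : ∃ s, j = i + s := ⟨j - i, by omega⟩
      refine hmin _ (by omega) _ (h.splice s (by omega) (heq ▸ h (i + s) hj)) (by simp) ?_
      simp [show ¬ k - s ≤ i by omega, show k - s + s = k by omega]
  refine ⟨h, fun {i j} hij hj hr => ?_, fun {i j} hi hj heq => ?_⟩
  · by_contra hne
    obtain ⟨s, rfl⟩ : ∃ s, j = i + s + 1 := ⟨j - i - 1, by omega⟩
    refine hmin _ (by omega) _ (h.splice s hj hr) (by simp) ?_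
    simp [show ¬ k - s ≤ i by omega, show k - s + s = k by omega]
  · rcases lt_trichotomy i j with hij | hij | hij
    · exact absurd heq (no_repeat hij hj)
    · exact hij
    · exact absurd heq.symm (no_repeat hij hi)

theorem exists_isGeodesic (h : Relation.ReflTransGen r a b) :
    ∃ k v, IsGeodesic r k v ∧ v 0 = a ∧ v k = b := by
  classical
  have hex := exists_isWalk h
  obtain ⟨v, hv, h0, hk⟩ := Nat.find_spec hex
  refine ⟨_, v, hv.isGeodesic_of_minimal fun m hm w hw hw0 hwm => ?_, h0, hk⟩
  exact Nat.find_min hex hm ⟨w, hw, hw0.trans h0, hwm.trans hk⟩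

theorem IsGeodesic.ne (h : IsGeodesic r k v) (hij : i < j) (hj : j ≤ k) : v i ≠ v j :=
  fun heq => hij.ne (h.inj (by omega) hj heq)

end Walks

theorem isChainGraph_iff :
    G.IsChainGraph ↔ ∀ a b, G.Edge a b → G.Reach b a → G.Edge b a := by
  constructor
  · intro hG a b hab hba
    by_contra hn
    obtain ⟨k, v, hv, rfl, rfl⟩ := exists_isGeodesic hba
    have two_le : 2 ≤ k := by
      rcases k with _ | _ | k
      · exact absurd rfl hab.ne
      · exact absurd (hv.isWalk 0 one_pos) hn
      · omega
    refine hG (k + 1) (fun i => Nat.casesOn i (v k) v) ⟨by omega, rfl, ?_, ?_, 0, by omega, hab, hn⟩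
    · rintro (_ | i) hi (_ | j) hj hij
      · rfl
      · exact absurd hij.symm (hv.ne (by simpa using hj) le_rfl)
      · exact absurd hij (hv.ne (by simpa using hi) le_rfl)
      · rw [hv.inj (Nat.le_of_lt_succ (Nat.lt_of_succ_lt hi))
          (Nat.le_of_lt_succ (Nat.lt_of_succ_lt hj)) hij]
    · rintro (_ | i) hi
      · exact hab
      · exact hv.isWalk i (by omega)
  · rintro h k v ⟨-, h0, -, hv, i, hi, harrow⟩
    have walk : IsWalk G.Edge k v := hv
    have to_end := walk.reflTransGen (show i + 1 ≤ k from hi) le_rfl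
    have from_start := walk.reflTransGen (Nat.zero_le i) hi.le
    exact harrow.2 (h _ _ harrow.1 (to_end.trans (h0 ▸ from_start)))

/-- `v 0, …, v k` is a chordless path from the head to the tail of an arrow. -/
structure IsChordlessCycle (G : MixedGraph V) (k : ℕ) (v : ℕ → V) : Prop where
  arrow : G.Arrow (v k) (v 0)
  isGeodesic : IsGeodesic G.Edge k v
  not_adj : ∀ {i j}, i + 1 < j → j ≤ k → ¬ (i = 0 ∧ j = k) → ¬ G.Adj (v i) (v j)

theorem exists_isChordlessCycle (h : ¬ G.IsChainGraph) : ∃ k v, G.IsChordlessCycle k v := by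
  classical
  have hex : ∃ k v, IsWalk G.Edge k v ∧ G.Arrow (v k) (v 0) := by
    rw [isChainGraph_iff] at h
    push Not at h
    obtain ⟨a, b, hab, hba, hn⟩ := h
    obtain ⟨k, v, hv, rfl, rfl⟩ := exists_isWalk hba
    exact ⟨k, v, hv, hab, hn⟩
  obtain ⟨v, hv, harrow⟩ := Nat.find_spec hex
  have hmin : ∀ m < Nat.find hex, ∀ w, IsWalk G.Edge m w → ¬ G.Arrow (w m) (w 0) :=
    fun m hm w hw hw' => Nat.find_min hex hm ⟨w, hw, hw'⟩
  generalize Nat.find hex = k at *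
  have geodesic : IsGeodesic G.Edge k v := hv.isGeodesic_of_minimal fun m hm w hw h0 hk =>
    hmin m hm w hw (by rwa [h0, hk])
  refine ⟨k, v, harrow, geodesic, fun {i j} hij hj hne hadj => ?_⟩
  have no_chord : ¬ G.Edge (v i) (v j) := fun h => by
    have := geodesic.chordless (by omega) hj h
    omega
  refine hmin (j - i) (by omega) _ (hv.shift (i := i) hj) ?_
  simpa [show i + (j - i) = j by omega] using hadj.symm.arrow_of_not_edge no_chord

namespace IsChainGraph

theorem edge_symm (hG : G.IsChainGraph) (h : G.Edge a b) (h' : G.Reach b a) : G.Edge b a :=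
  isChainGraph_iff.1 hG a b h h'

theorem not_reach (hG : G.IsChainGraph) (h : G.Arrow a b) : ¬ G.Reach b a :=
  fun h' => h.2 (hG.edge_symm h.1 h')

theorem edge_of_reach (hG : G.IsChainGraph) (h : G.Adj a b) (h' : G.Reach a b) : G.Edge a b :=
  h.elim id fun h => hG.edge_symm h h'

theorem edge_trans (hG : G.IsChainGraph) (h : G.Edge a b) (h' : G.Edge b c) (hac : G.Adj a c) :
    G.Edge a c :=
  hG.edge_of_reach hac (h.reach.trans h'.reach)

theorem arrow_trans_edge (hG : G.IsChainGraph) (h : G.Arrow a b) (h' : G.Edge b c)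
    (hac : G.Adj a c) : G.Arrow a c :=
  ⟨hG.edge_trans h.1 h' hac, fun h'' => hG.not_reach h (h'.reach.trans h''.reach)⟩

theorem edge_trans_arrow (hG : G.IsChainGraph) (h : G.Edge a b) (h' : G.Arrow b c)
    (hac : G.Adj a c) : G.Arrow a c :=
  ⟨hG.edge_trans h h'.1 hac, fun h'' => hG.not_reach h' (h''.reach.trans h.reach)⟩

theorem line_trans (hG : G.IsChainGraph) (h : G.Line a b) (h' : G.Line b c) (hac : G.Adj a c) :
    G.Line a c :=
  ⟨hG.edge_trans h.1 h'.1 hac, hG.edge_trans h'.2 h.2 hac.symm⟩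

theorem exists_line_of_reach (hG : G.IsChainGraph) (h : G.Reach a b) (h' : G.Reach b a)
    (hne : a ≠ b) : ∃ c, G.Line a c := by
  rcases Relation.ReflTransGen.cases_head h with rfl | ⟨c, hac, hcb⟩
  · exact absurd rfl hne
  · exact ⟨c, hac, hG.edge_symm hac (Reach.trans hcb h')⟩

theorem reflTransGen_line (hG : G.IsChainGraph) (hle : ∀ a b, K.Edge a b → G.Edge a b)
    (hab : K.Edge a b) (hba : K.Reach b a) :
    Relation.ReflTransGen (fun x y => K.Edge x y ∧ G.Edge y x) b a := by
  suffices ∀ x, K.Reach b x → K.Reach x a →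
      Relation.ReflTransGen (fun x y => K.Edge x y ∧ G.Edge y x) b x from this a hba (Reach.refl a)
  intro x hbx
  induction hbx with
  | refl => exact fun _ => .refl
  | @tail y z hby hyz ih =>
    intro hza
    have hzy : K.Reach z y := hza.trans (hab.reach.trans hby)
    exact (ih (.head hyz hza)).tail ⟨hyz, hG.edge_symm (hle y z hyz) (hzy.mono hle)⟩

end IsChainGraph

/-! ### Triplex equivalence -/

namespace Triplex

theorem symm (h : G.Triplex a b c) : G.Triplex c b a :=
  ⟨h.1.symm, fun h' => h.2.1 h'.symm, h.2.2.2.1, h.2.2.1, h.2.2.2.2.symm⟩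

theorem not_adj (h : G.Triplex a b c) : ¬ G.Adj a c := h.2.1

theorem edge_left (h : G.Triplex a b c) : G.Edge a b := h.2.2.1

theorem edge_right (h : G.Triplex a b c) : G.Edge c b := h.2.2.2.1

theorem arrow (h : G.Triplex a b c) : G.Arrow a b ∨ G.Arrow c b := h.2.2.2.2

end Triplex

/-- The same skeleton and the same triplexes: the graphical criterion for Markov equivalence of
chain graphs. -/
structure TriplexEquiv (G H : MixedGraph V) : Prop where
  sameSkeleton : SameSkeleton G H
  triplex_iff : ∀ {a b c}, G.Triplex a b c ↔ H.Triplex a b c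

namespace TriplexEquiv

theorem adj_iff (h : TriplexEquiv G H) : G.Adj a b ↔ H.Adj a b := h.sameSkeleton a b

theorem refl (G : MixedGraph V) : TriplexEquiv G G := ⟨fun _ _ => Iff.rfl, Iff.rfl⟩

theorem symm (h : TriplexEquiv G H) : TriplexEquiv H G :=
  ⟨fun _ _ => h.adj_iff.symm, h.triplex_iff.symm⟩

theorem trans (h : TriplexEquiv G H) (h' : TriplexEquiv H K) : TriplexEquiv G K :=
  ⟨fun _ _ => h.adj_iff.trans h'.adj_iff, h.triplex_iff.trans h'.triplex_iff⟩

theorem adj_of_reversed (h : TriplexEquiv G H) (hab : G.Edge a b) (hcb : G.Arrow c b)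
    (hcb' : ¬ H.Edge c b) (hne : a ≠ c) : G.Adj a c := by
  by_contra hn
  exact hcb' (h.triplex_iff.1 ⟨hne, hn, hab, hcb.1, Or.inr hcb⟩).edge_right

theorem edge_or_line_of_unshielded (h : TriplexEquiv G H) (hxy : G.Edge a b) (hyz : H.Edge b c)
    (hn : ¬ H.Adj a c) (hne : a ≠ c) :
    G.Edge b c ∨ (H.Line b c ∧ G.Triplex a b c ∧ G.Arrow c b) := by
  by_cases hbc : G.Edge b c
  · exact Or.inl hbc
  · have hcb := (h.adj_iff.2 (Or.inl hyz)).symm.arrow_of_not_edge hbc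
    have ht : G.Triplex a b c := ⟨hne, fun h' => hn (h.adj_iff.1 h'), hxy, hcb.1, Or.inr hcb⟩
    exact Or.inr ⟨⟨hyz, (h.triplex_iff.1 ht).edge_right⟩, ht, hcb⟩

end TriplexEquiv

/-- The graph `G` with those lines oriented that are arrows in `H`, as in `H`. -/
def refine (G H : MixedGraph V) : MixedGraph V where
  Edge a b := G.Edge a b ∧ (H.Edge a b ∨ ¬ G.Edge b a)
  irrefl a h := G.irrefl a h.1

theorem Arrow.refine (h : G.Arrow a b) : (G.refine H).Arrow a b :=
  ⟨⟨h.1, Or.inr h.2⟩, fun h' => h.2 h'.1⟩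

theorem refine_line (h : SameSkeleton G H) : (G.refine H).Line a b ↔ G.Line a b ∧ H.Line a b := by
  have := h a b
  simp only [Line, Adj, refine] at *
  tauto

theorem IsChainGraph.refine (hG : G.IsChainGraph) (hH : H.IsChainGraph) :
    (G.refine H).IsChainGraph := by
  have hle : ∀ a b, (G.refine H).Edge a b → G.Edge a b := fun _ _ h => h.1
  have edge_of_line : ∀ x y, (G.refine H).Edge x y ∧ G.Edge y x → H.Edge x y :=
    fun _ _ h => h.1.2.resolve_right (not_not.2 h.2)
  rw [isChainGraph_iff]
  intro a b hab hba
  have hba_G : G.Edge b a := hG.edge_symm hab.1 (hba.mono hle)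
  have hba_H : H.Reach b a :=
    Relation.ReflTransGen.mono edge_of_line _ _ (hG.reflTransGen_line hle hab hba)
  exact ⟨hba_G, Or.inl (hH.edge_symm (edge_of_line a b ⟨hab, hba_G⟩) hba_H)⟩

theorem TriplexEquiv.refine (h : TriplexEquiv G H) : TriplexEquiv (G.refine H) G := by
  have refine_adj : ∀ {x y}, (G.refine H).Adj x y ↔ G.Adj x y := by
    intro x y
    have := h.adj_iff (a := x) (b := y)
    simp only [Adj, MixedGraph.refine] at *
    tauto
  refine ⟨fun a b => refine_adj, fun {a b c} => ?_⟩
  have := h.adj_iff (a := a) (b := b)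
  have := h.adj_iff (a := c) (b := b)
  have := h.adj_iff (a := a) (b := c)
  have := h.triplex_iff (a := a) (b := b) (c := c)
  simp only [Triplex, refine_adj] at *
  simp only [Adj, Arrow, MixedGraph.refine] at *
  grind

/-! ### Maximally oriented members -/

/-- The chain graphs with the skeleton and the triplexes of `G₀`. -/
def triplexClass (G₀ : MixedGraph V) : Set (MixedGraph V) :=
  {G | G.IsChainGraph ∧ TriplexEquiv G G₀}

/-- A member of the triplex class of `G₀` whose lines are lines of all members. Such members
differ from each other only in the orientation of arrows. -/
structure IsMaxOriented (G₀ D : MixedGraph V) : Prop where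
  isChainGraph : D.IsChainGraph
  triplexEquiv : TriplexEquiv D G₀
  line_of_line : ∀ {a b}, D.Line a b → ∀ G ∈ triplexClass G₀, G.Line a b

theorem triplexEquiv_of_mem (hG : G ∈ triplexClass G₀) (hH : H ∈ triplexClass G₀) :
    TriplexEquiv G H :=
  hG.2.trans hH.2.symm

theorem refine_mem (hG : G ∈ triplexClass G₀) (hH : H ∈ triplexClass G₀) :
    G.refine H ∈ triplexClass G₀ :=
  ⟨hG.1.refine hH.1, (triplexEquiv_of_mem hG hH).refine.trans hG.2⟩

instance [Finite V] : Finite (MixedGraph V) :=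
  Finite.of_injective (fun G : MixedGraph V => G.Edge) fun _ _ h => MixedGraph.ext h

theorem exists_isMaxOriented [Finite V] (hG : G ∈ triplexClass G₀) : ∃ D, IsMaxOriented G₀ D := by
  obtain ⟨D, hD, hmin⟩ := Set.exists_min_image (triplexClass G₀)
    (fun G => {p : V × V | G.Line p.1 p.2}.ncard) (Set.toFinite _) ⟨G, hG⟩
  refine ⟨D, hD.1, hD.2, fun {a b} hab H hH => ?_⟩
  by_contra hn
  have hline := fun a b => refine_line (a := a) (b := b) (triplexEquiv_of_mem hD hH).sameSkeleton
  have fewer_lines : {p : V × V | (D.refine H).Line p.1 p.2} ⊂ {p | D.Line p.1 p.2} :=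
    (Set.ssubset_iff_of_subset fun p hp => ((hline _ _).1 hp).1).2
      ⟨(a, b), hab, fun h => hn ((hline a b).1 h).2⟩
  exact (hmin _ (refine_mem hD hH)).not_gt (Set.ncard_lt_ncard fewer_lines (Set.toFinite _))

namespace IsMaxOriented

theorem mem (hD : IsMaxOriented G₀ D) : D ∈ triplexClass G₀ := ⟨hD.isChainGraph, hD.triplexEquiv⟩

theorem equiv (hD : IsMaxOriented G₀ D) (hE : IsMaxOriented G₀ E) : TriplexEquiv D E :=
  triplexEquiv_of_mem hD.mem hE.mem

theorem refine (hD : IsMaxOriented G₀ D) (hG : G ∈ triplexClass G₀) :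
    IsMaxOriented G₀ (G.refine D) where
  isChainGraph := (refine_mem hG hD.mem).1
  triplexEquiv := (refine_mem hG hD.mem).2
  line_of_line h :=
    hD.line_of_line ((refine_line (triplexEquiv_of_mem hG hD.mem).sameSkeleton).1 h).2

theorem line_iff (hD : IsMaxOriented G₀ D) (hE : IsMaxOriented G₀ E) : D.Line a b ↔ E.Line a b :=
  ⟨fun h => hD.line_of_line h E hE.mem, fun h => hE.line_of_line h D hD.mem⟩

theorem arrow_or_arrow (hD : IsMaxOriented G₀ D) (hE : IsMaxOriented G₀ E) (h : D.Arrow a b) :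
    E.Arrow a b ∨ E.Arrow b a := by
  rcases adj_iff_arrow_or_line.1 ((hD.equiv hE).adj_iff.1 h.adj) with h' | h' | h'
  · exact Or.inl h'
  · exact absurd ((hD.line_iff hE).2 h').2 h.2
  · exact Or.inr h'

end IsMaxOriented

/-! ### Splitting chain components and reversing arrows -/

/-- The lines between `T` and its complement become arrows into `T`. -/
def split (G : MixedGraph V) (T : Set V) : MixedGraph V where
  Edge a b := G.Edge a b ∧ ¬ (a ∈ T ∧ b ∉ T ∧ G.Edge b a)
  irrefl a h := G.irrefl a h.1

/-- The conditions under which `split` changes no triplex. -/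
structure FeasibleSplit (G : MixedGraph V) (T : Set V) : Prop where
  joined : ∀ q ∉ T, ∀ t ∈ T, G.Line q t → ∀ t' ∈ T, G.Line q t'
  complete : ∀ q ∉ T, ∀ q' ∉ T, ∀ t ∈ T, G.Line q t → G.Line q' t → q ≠ q' → G.Line q q'
  parents : ∀ p, ∀ q ∉ T, ∀ t ∈ T, G.Arrow p q → G.Line q t → G.Arrow p t

theorem split_adj : (G.split T).Adj a b ↔ G.Adj a b := by
  simp only [Adj, split]
  tauto

theorem IsChainGraph.split (hG : G.IsChainGraph) (T : Set V) : (G.split T).IsChainGraph := by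
  have hle : ∀ a b, (G.split T).Edge a b → G.Edge a b := fun _ _ h => h.1
  rw [isChainGraph_iff]
  intro a b hab hba
  refine ⟨hG.edge_symm hab.1 (hba.mono hle), fun ⟨hb, ha, _⟩ => ha ?_⟩
  have stays : ∀ x, Relation.ReflTransGen (fun x y => (G.split T).Edge x y ∧ G.Edge y x) b x →
      x ∈ T := by
    intro x hbx
    induction hbx with
    | refl => exact hb
    | tail _ hyz ih => exact by_contra fun hz => hyz.1.2 ⟨ih, hz, hyz.2⟩
  exact stays a (hG.reflTransGen_line hle hab hba)

namespace FeasibleSplit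

theorem triplexEquiv (h : G.FeasibleSplit T) : TriplexEquiv (G.split T) G := by
  refine ⟨fun a b => split_adj, fun {a b c} => ?_⟩
  have hac := split_adj (G := G) (T := T) (a := a) (b := c)
  have := h.joined a
  have := h.joined c
  have := h.complete a
  have := h.parents a b
  have := h.parents c b
  simp only [Triplex, hac] at *
  simp only [Adj, Arrow, Line, split] at *
  grind

theorem mem (h : G.FeasibleSplit T) (hG : G ∈ triplexClass G₀) : G.split T ∈ triplexClass G₀ :=
  ⟨hG.1.split T, h.triplexEquiv.trans hG.2⟩

end FeasibleSplit

/-- An arrow `v → w` between vertices without lines such that `v` and `w` have the same parents,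
apart from `v`: these are the arrows that can be reversed on their own. -/
structure Covered (G : MixedGraph V) (v w : V) : Prop where
  arrow : G.Arrow v w
  no_line_left : ∀ z, ¬ G.Line v z
  no_line_right : ∀ z, ¬ G.Line w z
  parent_left : ∀ z, G.Edge z v → G.Edge z w
  parent_right : ∀ z, z ≠ v → G.Edge z w → G.Edge z v

/-- The arrow `v → w` is replaced by a line. -/
def merge (G : MixedGraph V) (v w : V) (h : v ≠ w) : MixedGraph V where
  Edge a b := G.Edge a b ∨ (a = w ∧ b = v)
  irrefl a := by
    rintro (h' | ⟨rfl, rfl⟩)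
    · exact G.irrefl a h'
    · exact h rfl

/-- The arrow `v → w` is reversed. -/
def flip (G : MixedGraph V) (v w : V) (h : v ≠ w) : MixedGraph V where
  Edge a b := (G.Edge a b ∧ ¬ (a = v ∧ b = w)) ∨ (a = w ∧ b = v)
  irrefl a := by
    rintro (h' | ⟨rfl, rfl⟩)
    · exact G.irrefl a h'.1
    · exact h rfl

namespace Covered

theorem ne (h : G.Covered v w) : v ≠ w := h.arrow.1.ne

theorem merge_split_right (h : G.Covered v w) : (G.merge v w h.ne).split {w} = G := by
  ext a b
  have := h.no_line_right
  have := h.arrow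
  have := h.ne
  simp only [split, merge, Line, Arrow, Set.mem_singleton_iff] at *
  grind

theorem merge_split_left (h : G.Covered v w) :
    (G.merge v w h.ne).split {v} = G.flip v w h.ne := by
  ext a b
  have := h.no_line_left
  have := h.arrow
  have := h.ne
  simp only [split, merge, flip, Line, Arrow, Set.mem_singleton_iff] at *
  grind

theorem feasibleSplit_right (h : G.Covered v w) : (G.merge v w h.ne).FeasibleSplit {w} := by
  have := h.no_line_right
  have := h.arrow
  have := h.ne
  have := h.parent_left
  simp only [Arrow, Line] at *
  constructor <;> simp only [merge, Line, Arrow, Set.mem_singleton_iff] <;> grind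

theorem feasibleSplit_left (h : G.Covered v w) : (G.merge v w h.ne).FeasibleSplit {v} := by
  have := h.no_line_left
  have := h.no_line_right
  have := h.arrow
  have := h.ne
  have := h.parent_right
  simp only [Arrow, Line] at *
  constructor <;> simp only [merge, Line, Arrow, Set.mem_singleton_iff] <;> grind

theorem reach_of_merge (h : G.Covered v w) (hxy : (G.merge v w h.ne).Reach x y) :
    G.Reach x y ∨ (G.Reach x w ∧ G.Reach v y) := by
  induction hxy with
  | refl => exact Or.inl (Reach.refl _)
  | tail _ hyz ih =>
    rcases hyz with hyz | ⟨rfl, rfl⟩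
    · exact ih.imp (·.trans hyz.reach) fun h => ⟨h.1, h.2.trans hyz.reach⟩
    · exact Or.inr ⟨ih.elim id And.left, Reach.refl _⟩

theorem eq_or_reach (h : G.Covered v w) (hx : G.Reach x w) : x = w ∨ G.Reach x v := by
  rcases Relation.ReflTransGen.cases_tail hx with h' | ⟨z, hxz, hzw⟩
  · exact Or.inl h'.symm
  · by_cases hz : z = v
    · exact Or.inr (hz ▸ hxz)
    · exact Or.inr (Reach.trans hxz (h.parent_right z hz hzw).reach)

theorem isChainGraph_merge (h : G.Covered v w) (hG : G.IsChainGraph) :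
    (G.merge v w h.ne).IsChainGraph := by
  rw [isChainGraph_iff]
  rintro a b (hab | ⟨rfl, rfl⟩) hba
  · rcases h.reach_of_merge hba with hba | ⟨hbw, hva⟩
    · exact Or.inl (hG.edge_symm hab hba)
    · rcases h.eq_or_reach hbw with rfl | hbv
      · by_cases ha : a = v
        · exact Or.inr ⟨rfl, ha⟩
        · have hav := h.parent_right a ha hab
          exact absurd ⟨hG.edge_symm hav hva, hav⟩ (h.no_line_left a)
      · exact Or.inl (hG.edge_symm hab (hbv.trans hva))
  · exact Or.inl h.arrow.1

theorem flip_mem (h : G.Covered v w) (hG : G ∈ triplexClass G₀) :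
    G.flip v w h.ne ∈ triplexClass G₀ := by
  have merge_equiv : TriplexEquiv G (G.merge v w h.ne) := by
    simpa only [h.merge_split_right] using h.feasibleSplit_right.triplexEquiv
  rw [← h.merge_split_left]
  exact h.feasibleSplit_left.mem ⟨h.isChainGraph_merge hG.1, merge_equiv.symm.trans hG.2⟩

theorem flip_arrow_iff (h : G.Covered v w) :
    (G.flip v w h.ne).Arrow a b ↔ (G.Arrow a b ∧ ¬ (a = v ∧ b = w)) ∨ (a = w ∧ b = v) := by
  have := h.arrow
  have := h.ne
  simp only [flip, Arrow] at *
  grind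

theorem flip_arrow (h : G.Covered v w) : (G.flip v w h.ne).Arrow w v :=
  h.flip_arrow_iff.2 (Or.inr ⟨rfl, rfl⟩)

theorem isMaxOriented_flip (h : D.Covered v w) (hD : IsMaxOriented G₀ D) :
    IsMaxOriented G₀ (D.flip v w h.ne) where
  isChainGraph := (h.flip_mem hD.mem).1
  triplexEquiv := (h.flip_mem hD.mem).2
  line_of_line {a b} hab := hD.line_of_line <| by
    have := h.arrow
    simp only [Line, flip, Arrow] at *
    grind

end Covered

theorem reach_of_flip {hne : v ≠ w} (h : (G.flip v w hne).Reach x y) (hw : G.Reach w y) :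
    G.Reach x y := by
  induction h using Relation.ReflTransGen.head_induction_on with
  | refl => exact Reach.refl _
  | head h _ ih =>
    rcases h with h | ⟨rfl, rfl⟩
    · exact h.1.reach.trans ih
    · exact hw

/-! ### Reversible arrows -/

/-- The arrow between `a` and `b` occurs in both directions in maximally oriented members. -/
def Reversible (G₀ : MixedGraph V) (a b : V) : Prop :=
  (∃ D, IsMaxOriented G₀ D ∧ D.Arrow a b) ∧ ∃ D, IsMaxOriented G₀ D ∧ D.Arrow b a

theorem Reversible.symm (h : Reversible G₀ a b) : Reversible G₀ b a := And.symm h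

namespace IsMaxOriented

theorem reversible (hD : IsMaxOriented G₀ D) (hE : IsMaxOriented G₀ E) (h : D.Arrow a b)
    (h' : E.Arrow b a) : Reversible G₀ a b :=
  ⟨⟨D, hD, h⟩, E, hE, h'⟩

variable (hD : IsMaxOriented G₀ D) (hE : IsMaxOriented G₀ E)
include hD hE

theorem arrows_of_line_of_reversed (hxy : D.Arrow x y) (hyx : E.Arrow y x) (hm : E.Line x m) :
    E.Arrow y m ∧ D.Arrow m y := by
  have hmy : m ≠ y := by
    rintro rfl
    exact hyx.2 hm.1
  have hadj : E.Adj m y := (hE.equiv hD).adj_of_reversed hm.2 hyx hxy.2 hmy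
  exact ⟨hE.isChainGraph.arrow_trans_edge hyx hm.1 hadj.symm,
    hD.isChainGraph.edge_trans_arrow ((hE.line_iff hD).1 hm).2 hxy ((hE.equiv hD).adj_iff.1 hadj)⟩

theorem adj_of_line_line_of_reversed (hxy : D.Arrow x y) (hyx : E.Arrow y x) (hm : E.Line x m)
    (hr : E.Line m r) (hne : x ≠ r) : E.Adj x r := by
  obtain ⟨hym, hmy⟩ := hD.arrows_of_line_of_reversed hE hxy hyx hm
  obtain ⟨-, hry⟩ := hD.arrows_of_line_of_reversed hE hmy hym hr
  exact (hD.equiv hE).adj_iff.1 ((hD.equiv hE).adj_of_reversed hry.1 hxy hyx.2 hne.symm).symm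

theorem adj_of_arrow_line_of_reversed (hxy : D.Arrow x y) (hyx : E.Arrow y x) (hp : E.Arrow p x)
    (hr : E.Line x r) : E.Adj p r := by
  by_contra hn
  have hpr : p ≠ r := by
    rintro rfl
    exact hp.2 hr.1
  obtain ⟨hyr, hry⟩ := hD.arrows_of_line_of_reversed hE hxy hyx hr
  have hpy : p ≠ y := by
    rintro rfl
    exact hn hyr.adj
  have hpy_adj : E.Adj p y := (hE.equiv hD).adj_of_reversed hp.1 hyx hxy.2 hpy
  have triplex : D.Triplex p x r :=
    (hE.equiv hD).triplex_iff.1 ⟨hpr, hn, hp.1, hr.2, Or.inl hp⟩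
  have hpy_edge : D.Edge p y := hD.isChainGraph.edge_trans triplex.edge_left hxy.1
    ((hE.equiv hD).adj_iff.1 hpy_adj)
  exact hn ((hD.equiv hE).adj_iff.1 ((hD.equiv hE).adj_of_reversed hpy_edge hry hyr.2 hpr))

/-- Otherwise the neighbours of an end `x` of the arrow could be made its children. -/
theorem not_line_of_reversed (hxy : D.Arrow x y) (hyx : E.Arrow y x) : ¬ E.Line x m := by
  intro hm
  have only_x : ∀ q ∉ {m | E.Line x m}, ∀ t ∈ {m | E.Line x m}, E.Line q t → q = x := by
    intro q hq t ht hqt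
    by_contra hne
    exact hq (hE.isChainGraph.line_trans ht hqt.symm
      (hD.adj_of_line_line_of_reversed hE hxy hyx ht hqt.symm (Ne.symm hne)))
  have feasible : E.FeasibleSplit {m | E.Line x m} := by
    refine ⟨fun q hq t ht hqt t' ht' => ?_, fun q hq q' hq' t ht hqt hqt' hne => ?_,
      fun p q hq t ht hpq hqt => ?_⟩
    · rwa [only_x q hq t ht hqt]
    · exact absurd ((only_x q hq t ht hqt).trans (only_x q' hq' t ht hqt').symm) hne
    · obtain rfl := only_x q hq t ht hqt
      exact hE.isChainGraph.arrow_trans_edge hpq hqt.1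
        (hD.adj_of_arrow_line_of_reversed hE hxy hyx hpq hqt)
  have hline : (E.split {m | E.Line x m}).Line x m := hE.line_of_line hm _ (feasible.mem hE.mem)
  exact hline.2.2 ⟨hm, fun h => E.irrefl x h.1, hm.1⟩

end IsMaxOriented

namespace Reversible

theorem not_line (h : Reversible G₀ x y) (hE : IsMaxOriented G₀ E) : ¬ E.Line x m := by
  obtain ⟨⟨D₁, hD₁, h₁⟩, D₂, hD₂, h₂⟩ := h
  exact fun hm => hD₁.not_line_of_reversed hD₂ h₁ h₂ ((hE.line_iff hD₂).1 hm)

theorem arrow_out (h : Reversible G₀ x y) (hE : IsMaxOriented G₀ E) (he : E.Edge x m) :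
    E.Arrow x m :=
  ⟨he, fun h' => h.not_line hE ⟨he, h'⟩⟩

theorem arrow_in (h : Reversible G₀ x y) (hE : IsMaxOriented G₀ E) (he : E.Edge m x) :
    E.Arrow m x :=
  ⟨he, fun h' => h.not_line hE ⟨h', he⟩⟩

end Reversible

/-! ### Anterior sets and covered reversible arrows -/

/-- `T` is closed under passing to parents and neighbours. -/
def IsAnterior (G : MixedGraph V) (T : Set V) : Prop := ∀ ⦃a b⦄, G.Edge a b → b ∈ T → a ∈ T

/-- The set of vertices from which `b` can be reached. -/
def ant (G : MixedGraph V) (b : V) : Set V := {a | G.Reach a b}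

theorem isAnterior_ant (G : MixedGraph V) (b : V) : G.IsAnterior (G.ant b) :=
  fun _ _ h h' => h.reach.trans h'

theorem IsAnterior.ant_subset (h : G.IsAnterior T) (hb : b ∈ T) : G.ant b ⊆ T := by
  intro a hab
  induction hab using Relation.ReflTransGen.head_induction_on with
  | refl => exact hb
  | head hxy _ ih => exact h hxy ih

theorem IsAnterior.flip (h : G.IsAnterior T) (hw : w ∈ T) {hne : v ≠ w} :
    (G.flip v w hne).IsAnterior T := by
  rintro a b (hab | ⟨rfl, rfl⟩) hb
  · exact h hab.1 hb
  · exact hw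

theorem ant_flip_subset {hne : v ≠ w} (h : w ∈ G.ant b) : (G.flip v w hne).ant b ⊆ G.ant b :=
  fun _ hx => reach_of_flip hx h

theorem IsChainGraph.ant_ssubset (hG : G.IsChainGraph) (h : G.Arrow a b) : G.ant a ⊂ G.ant b :=
  (Set.ssubset_iff_of_subset fun _ hx => Reach.trans hx h.1.reach).2
    ⟨b, Reach.refl _, hG.not_reach h⟩

theorem Covered.ant_flip_ssubset (h : D.Covered v w) (hD : IsMaxOriented G₀ D) :
    (D.flip v w h.ne).ant w ⊂ D.ant w :=
  (Set.ssubset_iff_of_subset (ant_flip_subset (Reach.refl _))).2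
    ⟨v, h.arrow.1.reach, (h.isMaxOriented_flip hD).isChainGraph.not_reach h.flip_arrow⟩

theorem IsChainGraph.exists_minimal_head_maximal_tail [Finite V] (hG : G.IsChainGraph)
    {Δ : V → V → Prop} (hne : ∃ v w, Δ v w) : ∃ v w, Δ v w ∧ (∀ z u, Δ z u → ¬ G.Arrow u w) ∧
      ∀ z, Δ z w → ¬ G.Arrow v z := by
  have ncard_lt : ∀ {a b}, G.Arrow a b → (G.ant a).ncard < (G.ant b).ncard := fun h =>
    Set.ncard_lt_ncard (hG.ant_ssubset h) (Set.toFinite _)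
  obtain ⟨v₀, w₀, h₀⟩ := hne
  obtain ⟨w, ⟨v₁, hw⟩, hmin⟩ := Set.exists_min_image {w | ∃ v, Δ v w}
    (fun w => (G.ant w).ncard) (Set.toFinite _) ⟨w₀, v₀, h₀⟩
  obtain ⟨v, hv, hmax⟩ := Set.exists_max_image {v | Δ v w}
    (fun v => (G.ant v).ncard) (Set.toFinite _) ⟨v₁, hw⟩
  exact ⟨v, w, hv, fun z u hzu h => (hmin u ⟨z, hzu⟩).not_gt (ncard_lt h),
    fun z hz h => (hmax z hz).not_gt (ncard_lt h)⟩

theorem TriplexEquiv.edge_of_reversed (h : TriplexEquiv D E) (hD : D.IsChainGraph)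
    (hvw : D.Arrow v w) (hwv : E.Arrow w v) (hzv : D.Edge z v) (hzv' : E.Edge z v) :
    D.Edge z w := by
  have hzw : z ≠ w := by
    rintro rfl
    exact hvw.2 hzv
  exact hD.edge_trans hzv hvw.1 (h.adj_iff.2 (h.symm.adj_of_reversed hzv' hwv hvw.2 hzw))

/-- Among the arrows in question, one with a minimal head and, given its head, a maximal tail is
covered. -/
theorem exists_covered [Finite V] (hD : IsMaxOriented G₀ D) (hE : IsMaxOriented G₀ E)
    (hT : D.IsAnterior T) (hne : ∃ v w, D.Arrow v w ∧ E.Arrow w v ∧ w ∈ T) :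
    ∃ v w, D.Covered v w ∧ E.Arrow w v ∧ w ∈ T := by
  have hequiv := hD.equiv hE
  obtain ⟨v, w, ⟨hvw, hwv, hwT⟩, hmin, hmax⟩ := hD.isChainGraph.exists_minimal_head_maximal_tail hne
  have hrev := hD.reversible hE hvw hwv
  refine ⟨v, w, ⟨hvw, fun z => hrev.not_line hD, fun z => hrev.symm.not_line hD,
    fun z hzv => ?_, fun z hne hzw => ?_⟩, hwv, hwT⟩
  · have hzv := hrev.arrow_in hD hzv
    have hzv' : E.Arrow z v := (hD.arrow_or_arrow hE hzv).resolve_right fun h =>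
      hmin z v ⟨hzv, h, hT hvw.1 hwT⟩ hvw
    exact hequiv.edge_of_reversed hD.isChainGraph hvw hwv hzv.1 hzv'.1
  · have hzw := hrev.symm.arrow_in hD hzw
    have hadj := hequiv.adj_of_reversed hzw.1 hvw hwv.2 hne
    refine hadj.resolve_right fun hvz => ?_
    have hvz := hrev.arrow_out hD hvz
    have hzw' : E.Arrow z w := (hD.arrow_or_arrow hE hzw).resolve_right fun h =>
      hmax z ⟨hzw, h, hwT⟩ hvz
    have hzv' := hE.isChainGraph.arrow_trans_edge hzw' hwv.1 (hequiv.adj_iff.1 hadj)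
    exact hmin v z ⟨hvz, hzv', hT hzw.1 hwT⟩ hzw

/-- The arrows of `D` that are reversed in `E`. -/
def reversedArrows (D E : MixedGraph V) : Set (V × V) :=
  {e | D.Arrow e.1 e.2 ∧ E.Arrow e.2 e.1}

theorem Covered.reversedArrows_flip_ssubset (h : D.Covered v w) (hwv : E.Arrow w v) :
    reversedArrows (D.flip v w h.ne) E ⊂ reversedArrows D E := by
  refine (Set.ssubset_iff_of_subset ?_).2 ⟨(v, w), ⟨h.arrow, hwv⟩, fun h' => h'.1.2 h.flip_arrow.1⟩
  rintro ⟨x, y⟩ ⟨hxy, hyx⟩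
  rcases h.flip_arrow_iff.1 hxy with hxy | ⟨rfl, rfl⟩
  · exact ⟨hxy.1, hyx⟩
  · exact absurd hyx.1 hwv.2

/-- All members of the class have the in-arrows that `D` has at `c`. -/
def RootedAt (G₀ D : MixedGraph V) (c : V) : Prop :=
  ∀ p, D.Arrow p c → ∀ E, IsMaxOriented G₀ E → E.Arrow p c

namespace RootedAt

theorem arrow_of_reversible (hD : IsMaxOriented G₀ D) (h : RootedAt G₀ D c)
    (hr : Reversible G₀ x c) : D.Arrow c x := by
  obtain ⟨⟨E, hE, hxc⟩, F, hF, hcx⟩ := hr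
  exact (hE.arrow_or_arrow hD hxc).resolve_left fun h' => hcx.2 (h x h' F hF).1

theorem flip (h : RootedAt G₀ D c) (hcov : D.Covered v w) (hvc : v ≠ c) :
    RootedAt G₀ (D.flip v w hcov.ne) c := by
  intro p hp
  rcases hcov.flip_arrow_iff.1 hp with h' | h'
  · exact h p h'.1
  · exact absurd h'.2.symm hvc

end RootedAt

theorem exists_ant_ssubset [Finite V] (hD : IsMaxOriented G₀ D) (hE : IsMaxOriented G₀ E)
    (hT : D.IsAnterior T) (hc : c ∈ T) (hpc : D.Arrow p c) (hcp : E.Arrow c p) :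
    ∃ F, IsMaxOriented G₀ F ∧ F.IsAnterior T ∧ F.ant c ⊂ D.ant c := by
  induction hn : (reversedArrows D E).ncard using Nat.strong_induction_on generalizing D with
  | _ n ih =>
    obtain ⟨v, w, hcov, hwv, hw⟩ :=
      exists_covered hD hE (D.isAnterior_ant c) ⟨p, c, hpc, hcp, Reach.refl c⟩
    have hF := hcov.isMaxOriented_flip hD
    have hF_anterior : (D.flip v w hcov.ne).IsAnterior T := hT.flip (hT.ant_subset hc hw)
    by_cases hwc : w = c
    · subst hwc
      exact ⟨_, hF, hF_anterior, hcov.ant_flip_ssubset hD⟩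
    · obtain ⟨F, hF, hF_anterior, hF_ant⟩ := ih _
        (hn ▸ Set.ncard_lt_ncard (hcov.reversedArrows_flip_ssubset hwv) (Set.toFinite _)) hF
        hF_anterior (hcov.flip_arrow_iff.2 (Or.inl ⟨hpc, fun h => hwc h.2.symm⟩)) rfl
      exact ⟨F, hF, hF_anterior, hF_ant.trans_subset (ant_flip_subset hw)⟩

theorem exists_rootedAt [Finite V] (hD : IsMaxOriented G₀ D) (hT : D.IsAnterior T) (hc : c ∈ T) :
    ∃ D', IsMaxOriented G₀ D' ∧ RootedAt G₀ D' c ∧ D'.IsAnterior T := by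
  obtain ⟨D', ⟨hD', hT'⟩, hmin⟩ := Set.exists_min_image
    {F | IsMaxOriented G₀ F ∧ F.IsAnterior T} (fun F => (F.ant c).ncard) (Set.toFinite _)
    ⟨D, hD, hT⟩
  refine ⟨D', hD', fun p hp E hE => ?_, hT'⟩
  refine (hD'.arrow_or_arrow hE hp).resolve_right fun hcp => ?_
  obtain ⟨F, hF, hF_anterior, hF_ant⟩ := exists_ant_ssubset hD' hE hT' hc hp hcp
  exact (hmin F ⟨hF, hF_anterior⟩).not_gt (Set.ncard_lt_ncard hF_ant (Set.toFinite _))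

/-! ### Triangles with two reversible arrows -/

/-- Past an unshielded edge, `G` follows the edges of `H`. -/
def Follows (G H : MixedGraph V) : Prop :=
  ∀ ⦃x y z⦄, G.Edge x y → H.Edge y z → x ≠ z → ¬ H.Adj x z → G.Edge y z

theorem IsMaxOriented.follows (hD : IsMaxOriented G₀ D) (hE : IsMaxOriented G₀ E) :
    Follows E D := fun _ _ _ hxy hyz hne hn =>
  ((hE.equiv hD).edge_or_line_of_unshielded hxy hyz hn hne).resolve_right fun h =>
    h.2.2.2 ((hD.line_iff hE).1 h.1).1

theorem Follows.edge_of_isGeodesic {k l i : ℕ} {v : ℕ → V} (h : Follows G H)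
    (hv : IsGeodesic H.Edge k v) (hn : ∀ i, i + 2 ≤ k → ¬ H.Adj (v i) (v (i + 2)))
    (hl : G.Edge (v l) (v (l + 1))) (hli : l ≤ i) (hik : i < k) : G.Edge (v i) (v (i + 1)) := by
  induction i, hli using Nat.le_induction with
  | base => exact hl
  | succ i _ ih =>
    exact h (ih (by omega)) (hv.isWalk _ hik) (hv.ne (by omega) (by omega)) (hn i (by omega))

theorem IsChainGraph.not_adj_of_isGeodesic {k i j : ℕ} {v : ℕ → V} (hG : G.IsChainGraph)
    (hv : IsGeodesic G.Edge k v) (hij : i + 1 < j) (hj : j ≤ k) : ¬ G.Adj (v i) (v j) :=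
  fun hadj => hij.ne' <| hv.chordless (by omega) hj <|
    hG.edge_of_reach hadj (hv.isWalk.reflTransGen (by omega) hj)

theorem IsMaxOriented.eq_of_reach_reach (hD : IsMaxOriented G₀ D) (hbc : Reversible G₀ c b)
    (hcw : D.Reach c w) (hwc : D.Reach w c) : w = c := by
  by_contra hne
  obtain ⟨z, hz⟩ := hD.isChainGraph.exists_line_of_reach hcw hwc (Ne.symm hne)
  exact hbc.not_line hD hz

/-- Otherwise the last edges of a shortest path from `w` to `b` could be followed in `E`, starting
from the first vertex adjacent to `c`. -/
theorem IsMaxOriented.adj_of_between (hD : IsMaxOriented G₀ D) (hE : IsMaxOriented G₀ E)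
    (hbc : Reversible G₀ b c) (hE' : E.Arrow b c) (hcw : D.Reach c w) (hwb : D.Reach w b)
    (hne : w ≠ c) : D.Adj c w := by
  by_contra hn
  obtain ⟨k, p, hp, rfl, rfl⟩ := exists_isGeodesic hwb
  have from_c : ∀ i ≤ k, D.Reach c (p i) := fun i hi =>
    hcw.trans (hp.isWalk.reflTransGen (Nat.zero_le i) hi)
  have ne_c : ∀ i ≤ k, p i ≠ c := fun i hi h => hne <|
    hD.eq_of_reach_reach hbc.symm hcw (h ▸ hp.isWalk.reflTransGen (Nat.zero_le i) hi)
  classical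
  have hex : ∃ j, j ≤ k ∧ D.Adj c (p j) := ⟨k, le_rfl, ((hD.equiv hE).adj_iff.2 hE'.adj).symm⟩
  obtain ⟨hjk, hadj⟩ := Nat.find_spec hex
  have hmin : ∀ i < Nat.find hex, i ≤ k → ¬ D.Adj c (p i) := fun i hi hik h =>
    Nat.find_min hex hi ⟨hik, h⟩
  generalize Nat.find hex = j at *
  obtain ⟨i, rfl⟩ : ∃ i, j = i + 1 := Nat.exists_eq_succ_of_ne_zero fun h => hn (h ▸ hadj)
  have hcj : D.Arrow c (p (i + 1)) :=
    hbc.symm.arrow_out hD (hD.isChainGraph.edge_of_reach hadj (from_c _ hjk))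
  have triplex : E.Triplex c (p (i + 1)) (p i) :=
    (hD.equiv hE).triplex_iff.1 ⟨(ne_c i (by omega)).symm, hmin i (by omega) (by omega), hcj.1,
      hp.isWalk i hjk, Or.inl hcj⟩
  have tail : IsWalk E.Edge (k - (i + 1)) fun l => p (i + 1 + l) := fun l hl =>
    (hD.follows hE).edge_of_isGeodesic hp
      (fun i hi => hD.isChainGraph.not_adj_of_isGeodesic hp (by omega) hi) triplex.edge_right
      (by omega) (by omega)
  have hreach : Relation.ReflTransGen E.Edge (p (i + 1)) (p k) := by
    simpa [show i + 1 + (k - (i + 1)) = k by omega] using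
      tail.reflTransGen (Nat.zero_le _) le_rfl
  exact hE.isChainGraph.not_reach hE' (triplex.edge_left.reach.trans hreach)

/-- A triangle with the arrow `a → b` in all maximally oriented members and reversible edges
`a c` and `b c`. The member `D` is rooted at `c`, so both of these edges are oriented away from
`c` in `D`, and the edge `b c` is reversed in the member `E`. -/
structure BadTriangle (G₀ D E : MixedGraph V) (a b c : V) : Prop where
  isMaxOriented_left : IsMaxOriented G₀ D
  isMaxOriented_right : IsMaxOriented G₀ E
  rootedAt : RootedAt G₀ D c
  arrow : ∀ F, IsMaxOriented G₀ F → F.Arrow a b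
  reversible_left : Reversible G₀ a c
  reversible_right : Reversible G₀ b c
  reversed : E.Arrow b c

/-- The arrow `v → w` of `D` is reversed in `E`, lies strictly above `b` and does not leave `c`. -/
structure ReversedAbove (D E : MixedGraph V) (b c v w : V) : Prop where
  arrow : D.Arrow v w
  reversed : E.Arrow w v
  mem_ant : w ∈ D.ant b
  head_ne : w ≠ b
  tail_ne : v ≠ c

/-- The measure by which bad triangles descend. -/
noncomputable def triangleSize (D E : MixedGraph V) (b : V) : ℕ ×ₗ ℕ :=
  toLex ((D.ant b).ncard, (reversedArrows D E).ncard)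

theorem triangleSize_lt_of_ant [Finite V] {D' E' : MixedGraph V} {b' : V}
    (h : D'.ant b' ⊂ D.ant b) : triangleSize D' E' b' < triangleSize D E b :=
  Prod.Lex.toLex_lt_toLex.2 (Or.inl (Set.ncard_lt_ncard h (Set.toFinite _)))

theorem Covered.triangleSize_flip_lt [Finite V] (hcov : D.Covered v w) (hwv : E.Arrow w v)
    (hw : w ∈ D.ant b) : triangleSize (D.flip v w hcov.ne) E b < triangleSize D E b := by
  refine Prod.Lex.toLex_lt_toLex.2 ((Set.ncard_le_ncard (ant_flip_subset hw)
    (Set.toFinite _)).lt_or_eq.imp_right fun h => ⟨h, ?_⟩)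
  exact Set.ncard_lt_ncard (hcov.reversedArrows_flip_ssubset hwv) (Set.toFinite _)

namespace BadTriangle

variable (h : BadTriangle G₀ D E a b c)
include h

theorem equiv : TriplexEquiv D E := h.isMaxOriented_left.equiv h.isMaxOriented_right

theorem arrow_left : D.Arrow c a :=
  h.rootedAt.arrow_of_reversible h.isMaxOriented_left h.reversible_left

theorem arrow_right : D.Arrow c b :=
  h.rootedAt.arrow_of_reversible h.isMaxOriented_left h.reversible_right

theorem flip (hcov : D.Covered v w) (hvc : v ≠ c) :
    BadTriangle G₀ (D.flip v w hcov.ne) E a b c :=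
  { h with
    isMaxOriented_left := hcov.isMaxOriented_flip h.isMaxOriented_left
    rootedAt := h.rootedAt.flip hcov hvc }

theorem reversible_of_reversedAbove (hvw : ReversedAbove D E b c v w) : Reversible G₀ v w :=
  h.isMaxOriented_left.reversible h.isMaxOriented_right hvw.arrow hvw.reversed

theorem reversedAbove_of_arrow (hvw : ReversedAbove D E b c v w) (hxy : D.Arrow x y)
    (hyx : E.Arrow y x) (hyw : D.Reach y w) (hyb : D.Arrow y z) (hz : z ∈ D.ant b) (hxc : x ≠ c) :
    ReversedAbove D E b c x y := by
  refine ⟨hxy, hyx, hyw.trans hvw.mem_ant, ?_, hxc⟩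
  rintro rfl
  exact h.isMaxOriented_left.isChainGraph.not_reach hyb hz

theorem edge_of_extremal (hvw : ReversedAbove D E b c v w)
    (hmin : ∀ z u, ReversedAbove D E b c z u → ¬ D.Arrow u w) (hzv : D.Edge z v) :
    D.Edge z w := by
  have hrev := h.reversible_of_reversedAbove hvw
  have hD := h.isMaxOriented_left
  have hzv := hrev.arrow_in hD hzv
  rcases hD.arrow_or_arrow h.isMaxOriented_right hzv with hzv' | hvz'
  · exact h.equiv.edge_of_reversed hD.isChainGraph hvw.arrow hvw.reversed hzv.1 hzv'.1
  · by_cases hzc : z = c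
    · subst hzc
      have hzw : D.Reach z w := hzv.1.reach.trans hvw.arrow.1.reach
      have hwz : w ≠ z := by
        rintro rfl
        exact hzv.2 hvw.arrow.1
      exact hD.isChainGraph.edge_of_reach (hD.adj_of_between h.isMaxOriented_right
        h.reversible_right h.reversed hzw hvw.mem_ant hwz) hzw
    · exact absurd hvw.arrow (hmin z v (h.reversedAbove_of_arrow hvw hzv hvz' hvw.arrow.1.reach
        hvw.arrow hvw.mem_ant hzc))

theorem edge_or_eq_of_extremal (hvw : ReversedAbove D E b c v w)
    (hmin : ∀ z u, ReversedAbove D E b c z u → ¬ D.Arrow u w)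
    (hmax : ∀ z, ReversedAbove D E b c z w → ¬ D.Arrow v z) (hzw : D.Edge z w) (hne : z ≠ v) :
    D.Edge z v ∨ (z = c ∧ D.Arrow v c) := by
  have hrev := h.reversible_of_reversedAbove hvw
  have hD := h.isMaxOriented_left
  have hzw := hrev.symm.arrow_in hD hzw
  have hadj : D.Adj z v := h.equiv.adj_of_reversed hzw.1 hvw.arrow hvw.reversed.2 hne
  refine hadj.imp_right fun hvz => ?_
  have hvz := hrev.arrow_out hD hvz
  suffices z = c from ⟨this, this ▸ hvz⟩
  by_contra hzc
  have hzw' : E.Arrow z w := (hD.arrow_or_arrow h.isMaxOriented_right hzw).resolve_right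
    fun h' => hmax z { hvw with arrow := hzw, reversed := h', tail_ne := hzc } hvz
  have hzv' := h.isMaxOriented_right.isChainGraph.arrow_trans_edge hzw' hvw.reversed.1
    (h.equiv.adj_iff.1 hadj)
  exact hmin v z (h.reversedAbove_of_arrow hvw hvz hzv' hzw.1.reach hzw hvw.mem_ant hvw.tail_ne) hzw

theorem exists_smaller_of_arrow [Finite V] (hvw : ReversedAbove D E b c v w) (hvc : D.Arrow v c)
    (hcw : D.Edge c w) :
    ∃ D', BadTriangle G₀ D' D v c w ∧ triangleSize D' D c < triangleSize D E b := by
  have hD := h.isMaxOriented_left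
  have hE := h.isMaxOriented_right
  have hrev := h.reversible_of_reversedAbove hvw
  have hcw := hrev.symm.arrow_in hD hcw
  have hwc : E.Arrow w c := hE.isChainGraph.arrow_trans_edge hvw.reversed
    (h.rootedAt v hvc E hE).1 (h.equiv.adj_iff.1 hcw.adj.symm)
  obtain ⟨D', hD', hroot, hanterior⟩ := exists_rootedAt hD (D.isAnterior_ant w) (Reach.refl w)
  refine ⟨D', ⟨hD', hD, hroot, h.rootedAt v hvc, hrev, hD.reversible hE hcw hwc, hcw⟩,
    triangleSize_lt_of_ant ?_⟩
  refine (hanterior.ant_subset hcw.1.reach).trans_ssubset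
    ((Set.ssubset_iff_of_subset fun x hx => Reach.trans hx hvw.mem_ant).2
      ⟨b, Reach.refl b, fun hb => hvw.head_ne ?_⟩)
  exact hD.eq_of_reach_reach h.reversible_right hb hvw.mem_ant

theorem exists_smaller_of_reversedAbove [Finite V] (hne : ∃ v w, ReversedAbove D E b c v w) :
    ∃ D' E' a' b' c', BadTriangle G₀ D' E' a' b' c' ∧
      triangleSize D' E' b' < triangleSize D E b := by
  obtain ⟨v, w, hvw, hmin, hmax⟩ :=
    h.isMaxOriented_left.isChainGraph.exists_minimal_head_maximal_tail hne
  have hrev := h.reversible_of_reversedAbove hvw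
  by_cases hsmaller : D.Arrow v c ∧ D.Edge c w
  · obtain ⟨D', h', hlt⟩ := h.exists_smaller_of_arrow hvw hsmaller.1 hsmaller.2
    exact ⟨D', D, v, c, w, h', hlt⟩
  · have hcov : D.Covered v w := by
      refine ⟨hvw.arrow, fun z => hrev.not_line h.isMaxOriented_left,
        fun z => hrev.symm.not_line h.isMaxOriented_left,
        fun z => h.edge_of_extremal hvw hmin, fun z hne hzw => ?_⟩
      refine (h.edge_or_eq_of_extremal hvw hmin hmax hzw hne).resolve_right ?_
      rintro ⟨rfl, hvz⟩
      exact hsmaller ⟨hvz, hzw⟩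
    exact ⟨_, E, a, b, c, h.flip hcov hvw.tail_ne,
      hcov.triangleSize_flip_lt hvw.reversed hvw.mem_ant⟩

theorem adj_of_arrow (hzb : D.Arrow z b) (hzc : z ≠ c) : D.Adj z c :=
  h.equiv.adj_of_reversed hzb.1 h.arrow_right h.reversed.2 hzc

theorem arrow_of_maximal (hqb : D.Arrow q b) (hmax : ∀ z, D.Arrow z b → ¬ D.Arrow q z) :
    D.Arrow c q := by
  have hqc : q ≠ c := by
    rintro rfl
    exact hmax a (h.arrow D h.isMaxOriented_left) h.arrow_left
  rcases h.adj_of_arrow hqb hqc with hqc | hcq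
  · exact absurd (h.reversible_right.symm.arrow_in h.isMaxOriented_left hqc)
      (hmax c h.arrow_right)
  · exact h.reversible_right.symm.arrow_out h.isMaxOriented_left hcq

theorem exists_reversible_of_arrow (hqb : D.Arrow q b) (hcq : D.Arrow c q) :
    ∃ x, Reversible G₀ q x := by
  have hD := h.isMaxOriented_left
  have hE := h.isMaxOriented_right
  rcases hD.arrow_or_arrow hE hqb with hqb' | hbq'
  · exact ⟨c, hE.reversible hD (hE.isChainGraph.arrow_trans_edge hqb' h.reversed.1
      (h.equiv.adj_iff.1 hcq.adj.symm)) hcq⟩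
  · exact ⟨b, hD.reversible hE hqb hbq'⟩

theorem adj_of_arrow_of_arrow (hqb : D.Arrow q b) (hcq : D.Arrow c q) (hzb : D.Arrow z b)
    (hne : z ≠ q) : D.Adj z q := by
  have hE := h.isMaxOriented_right
  by_contra hn
  have triplex : E.Triplex z b q := h.equiv.triplex_iff.1 ⟨hne, hn, hzb.1, hqb.1, Or.inl hzb⟩
  have hzc : z ≠ c := by
    rintro rfl
    exact hn hcq.adj
  have hzc_edge : E.Edge z c := hE.isChainGraph.edge_trans triplex.edge_left h.reversed.1
    (h.equiv.adj_iff.1 (h.adj_of_arrow hzb hzc))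
  have hqc_arrow : E.Arrow q c := hE.isChainGraph.edge_trans_arrow triplex.edge_right h.reversed
    (h.equiv.adj_iff.1 hcq.adj.symm)
  exact hn (h.equiv.adj_iff.2 (h.equiv.symm.adj_of_reversed hzc_edge hqc_arrow hcq.2 hne))

theorem edge_of_not_reversedAbove (hnone : ∀ v w, ¬ ReversedAbove D E b c v w)
    (hqb : D.Arrow q b) (hcq : D.Arrow c q) (hyq : D.Arrow y q) : D.Edge y b := by
  have hD := h.isMaxOriented_left
  have hE := h.isMaxOriented_right
  by_contra hn
  have hn' : ¬ D.Adj y b := fun h' => hn (hD.isChainGraph.edge_trans hyq.1 hqb.1 h')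
  have hyb : y ≠ b := by
    rintro rfl
    exact hyq.2 hqb.1
  have hyc : y ≠ c := by
    rintro rfl
    exact hn h.arrow_right.1
  have not_both : E.Edge c q → ¬ E.Edge y q := fun hcq' hyq' => by
    have hbq : E.Arrow b q := hE.isChainGraph.arrow_trans_edge h.reversed hcq'
      (h.equiv.adj_iff.1 hqb.adj.symm)
    exact hn' (h.equiv.adj_iff.2 (h.equiv.symm.adj_of_reversed hyq' hbq hqb.2 hyb))
  have hadj : D.Adj y c := by
    by_contra hn_yc
    have triplex : E.Triplex y q c :=
      h.equiv.triplex_iff.1 ⟨hyc, hn_yc, hyq.1, hcq.1, Or.inl hyq⟩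
    exact not_both triplex.edge_right triplex.edge_left
  have hcy : E.Edge c y := (h.equiv.adj_iff.1 hadj).resolve_left fun hyc' =>
    hn' (h.equiv.adj_iff.2 (h.equiv.symm.adj_of_reversed hyc' h.reversed h.arrow_right.2 hyb))
  rcases hD.arrow_or_arrow hE hyq with hyq' | hqy'
  · exact not_both (hE.isChainGraph.edge_trans hcy hyq'.1 (h.equiv.adj_iff.1 hcq.adj)) hyq'.1
  · exact hnone y q ⟨hyq, hqy', hqb.1.reach, hqb.adj.ne, hyc⟩

theorem exists_smaller_of_not_reversedAbove [Finite V]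
    (hnone : ∀ v w, ¬ ReversedAbove D E b c v w) :
    ∃ D', BadTriangle G₀ D' E a b c ∧ triangleSize D' E b < triangleSize D E b := by
  have hD := h.isMaxOriented_left
  obtain ⟨q, w, ⟨hqb, hwb⟩, -, hmax⟩ := hD.isChainGraph.exists_minimal_head_maximal_tail
    (Δ := fun q w => D.Arrow q w ∧ w = b) ⟨a, b, h.arrow D hD, rfl⟩
  subst w
  have hcq : D.Arrow c q := h.arrow_of_maximal hqb fun z hz => hmax z ⟨hz, rfl⟩
  obtain ⟨x, hqx⟩ := h.exists_reversible_of_arrow hqb hcq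
  have hcov : D.Covered q b := by
    refine ⟨hqb, fun z => hqx.not_line hD, fun z => h.reversible_right.not_line hD,
      fun y hyq => h.edge_of_not_reversedAbove hnone hqb hcq (hqx.arrow_in hD hyq),
      fun z hne hzb => ?_⟩
    have hzb := h.reversible_right.arrow_in hD hzb
    exact (h.adj_of_arrow_of_arrow hqb hcq hzb hne).resolve_right fun hqz =>
      hmax z ⟨hzb, rfl⟩ (hqx.arrow_out hD hqz)
  exact ⟨_, h.flip hcov hcq.adj.ne.symm, triangleSize_lt_of_ant (hcov.ant_flip_ssubset hD)⟩

end BadTriangle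

theorem not_badTriangle [Finite V] : ¬ BadTriangle G₀ D E a b c := by
  intro h
  induction hn : triangleSize D E b using WellFoundedLT.induction generalizing D E a b c with
  | _ n ih =>
    subst hn
    by_cases hne : ∃ v w, ReversedAbove D E b c v w
    · obtain ⟨D', E', a', b', c', h', hlt⟩ := h.exists_smaller_of_reversedAbove hne
      exact ih _ hlt h' rfl
    · push Not at hne
      obtain ⟨D', h', hlt⟩ := h.exists_smaller_of_not_reversedAbove hne
      exact ih _ hlt h' rfl

theorem not_reversible_triangle [Finite V] (hab : ∀ E, IsMaxOriented G₀ E → E.Arrow a b)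
    (hac : Reversible G₀ a c) (hbc : Reversible G₀ b c) : False := by
  obtain ⟨E, hE, hbc'⟩ := hbc.1
  obtain ⟨D, hD, hroot, -⟩ := exists_rootedAt hE (T := Set.univ) (fun _ _ _ _ => trivial)
    (Set.mem_univ c)
  exact not_badTriangle ⟨hD, hE, hroot, hab, hac, hbc, hbc'⟩

/-! ### The essential graph of a triplex class -/

theorem essentialGraph_edge_iff (hG : G ∈ triplexClass G₀) :
    (essentialGraph (triplexClass G₀)).Edge a b ↔ G.Adj a b ∧
      ((∃ H ∈ triplexClass G₀, H.Arrow b a) → ∃ H ∈ triplexClass G₀, H.Arrow a b) := by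
  have hadj : ∀ H ∈ triplexClass G₀, (H.Adj a b ↔ G.Adj a b) := fun H hH =>
    (triplexEquiv_of_mem hH hG).adj_iff
  constructor
  · rintro ⟨-, ⟨⟨H, hH, h⟩, -⟩ | h | ⟨⟨H, hH, h⟩, -⟩⟩
    · exact ⟨(hadj H hH).1 h.adj, fun _ => ⟨H, hH, h⟩⟩
    · exact ⟨(h G hG).adj, fun ⟨H, hH, h'⟩ => absurd (h H hH).1 h'.2⟩
    · exact ⟨(hadj H hH).1 h.adj, fun _ => ⟨H, hH, h⟩⟩
  · rintro ⟨h, h'⟩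
    refine ⟨h.ne, ?_⟩
    by_cases hba : ∃ H ∈ triplexClass G₀, H.Arrow b a
    · exact Or.inr (Or.inr ⟨h' hba, hba⟩)
    · push Not at hba
      by_cases hab : ∃ H ∈ triplexClass G₀, H.Arrow a b
      · exact Or.inl ⟨hab, hba⟩
      · push Not at hab
        exact Or.inr (Or.inl fun H hH => ((adj_iff_arrow_or_line.1 ((hadj H hH).2 h)).resolve_left
          (hab H hH)).resolve_right (hba H hH))

theorem essentialGraph_sameSkeleton (hG : G ∈ triplexClass G₀) :
    SameSkeleton (essentialGraph (triplexClass G₀)) G := by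
  intro a b
  have comm : G.Adj b a ↔ G.Adj a b := ⟨Adj.symm, Adj.symm⟩
  rw [Adj, essentialGraph_edge_iff hG, essentialGraph_edge_iff hG, comm, ← and_or_left]
  exact and_iff_left_of_imp fun _ => by tauto

theorem EssentialArrow.triplex (hG : G ∈ triplexClass G₀)
    (hab : EssentialArrow (triplexClass G₀) a b)
    (hcb : (essentialGraph (triplexClass G₀)).Edge c b) (hn : ¬ G.Adj a c) (hne : a ≠ c) :
    G.Triplex a b c := by
  obtain ⟨⟨G₁, hG₁, hab₁⟩, hno⟩ := hab
  by_contra ht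
  have no_triplex : ∀ H ∈ triplexClass G₀, ¬ H.Triplex a b c := fun H hH h =>
    ht ((triplexEquiv_of_mem hH hG).triplex_iff.1 h)
  have not_adj : ∀ H ∈ triplexClass G₀, ¬ H.Adj a c := fun H hH h =>
    hn ((triplexEquiv_of_mem hH hG).adj_iff.1 h)
  obtain ⟨hadj, reversed_of⟩ := (essentialGraph_edge_iff hG).1 hcb
  have hbc₁ : G₁.Arrow b c := ((triplexEquiv_of_mem hG₁ hG).adj_iff.2 hadj).symm.arrow_of_not_edge
    fun h => no_triplex G₁ hG₁ ⟨hne, not_adj _ hG₁, hab₁.1, h, Or.inl hab₁⟩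
  obtain ⟨G₂, hG₂, hcb₂⟩ := reversed_of ⟨G₁, hG₁, hbc₁⟩
  exact hno G₂ hG₂ <| ((triplexEquiv_of_mem hG₁ hG₂).adj_iff.1 hab₁.adj).symm.arrow_of_not_edge
    fun h => no_triplex G₂ hG₂ ⟨hne, not_adj _ hG₂, h, hcb₂.1, Or.inr hcb₂⟩

theorem essentialGraph_triplexEquiv (hG : G ∈ triplexClass G₀) :
    TriplexEquiv (essentialGraph (triplexClass G₀)) G := by
  have hadj : ∀ {a b}, (essentialGraph (triplexClass G₀)).Adj a b ↔ G.Adj a b :=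
    essentialGraph_sameSkeleton hG _ _
  refine ⟨essentialGraph_sameSkeleton hG, fun {a b c} => ⟨?_, fun ht => ?_⟩⟩
  · rintro ⟨hne, hn, hab, hcb, h | h⟩
    · exact ((essentialGraph_arrow _ a b).1 h).triplex hG hcb (mt hadj.2 hn) hne
    · exact (((essentialGraph_arrow _ c b).1 h).triplex hG hab
        (fun h' => hn (hadj.2 h'.symm)) hne.symm).symm
  · have ht' : ∀ H ∈ triplexClass G₀, H.Triplex a b c := fun H hH =>
      (triplexEquiv_of_mem hH hG).triplex_iff.2 ht
    have hba : ∀ H ∈ triplexClass G₀, ¬ H.Arrow b a := fun H hH h => h.2 (ht' H hH).edge_left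
    have hbc : ∀ H ∈ triplexClass G₀, ¬ H.Arrow b c := fun H hH h => h.2 (ht' H hH).edge_right
    exact ⟨ht.1, mt hadj.1 ht.not_adj,
      (essentialGraph_edge_iff hG).2 ⟨Or.inl ht.edge_left, fun ⟨H, hH, h⟩ => absurd h (hba H hH)⟩,
      (essentialGraph_edge_iff hG).2 ⟨Or.inl ht.edge_right, fun ⟨H, hH, h⟩ => absurd h (hbc H hH)⟩,
      ht.arrow.imp (fun h => (essentialGraph_arrow _ a b).2 ⟨⟨G, hG, h⟩, hba⟩)
        fun h => (essentialGraph_arrow _ c b).2 ⟨⟨G, hG, h⟩, hbc⟩⟩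

theorem reversible_of_mem [Finite V] (hG : G ∈ triplexClass G₀) (hH : H ∈ triplexClass G₀)
    (h : G.Arrow a b) (h' : H.Arrow b a) : Reversible G₀ a b := by
  obtain ⟨D, hD⟩ := exists_isMaxOriented hG
  exact ⟨⟨_, hD.refine hG, h.refine⟩, _, hD.refine hH, h'.refine⟩

theorem EssentialArrow.edge (hab : EssentialArrow (triplexClass G₀) a b)
    (hG : G ∈ triplexClass G₀) : G.Edge a b := by
  obtain ⟨⟨G₁, hG₁, h₁⟩, hno⟩ := hab
  by_contra hn
  exact hno G hG (((triplexEquiv_of_mem hG₁ hG).adj_iff.1 h₁.adj).symm.arrow_of_not_edge hn)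

theorem EssentialArrow.arrow (hab : EssentialArrow (triplexClass G₀) a b)
    (hD : IsMaxOriented G₀ D) : D.Arrow a b := by
  refine ⟨hab.edge hD.mem, fun hba => ?_⟩
  obtain ⟨G₁, hG₁, h₁⟩ := hab.1
  exact h₁.2 (hD.line_of_line ⟨hab.edge hD.mem, hba⟩ G₁ hG₁).2

theorem essentialGraph_not_triangle [Finite V] (hG : G ∈ triplexClass G₀)
    (hab : EssentialArrow (triplexClass G₀) a b)
    (hbc : (essentialGraph (triplexClass G₀)).Edge b c)
    (hca : (essentialGraph (triplexClass G₀)).Edge c a) : False := by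
  have adj_of_adj : ∀ {x y}, ∀ H ∈ triplexClass G₀, G.Adj x y → H.Adj x y := fun H hH =>
    (triplexEquiv_of_mem hG hH).adj_iff.1
  obtain ⟨hbc_adj, bc_of_cb⟩ := (essentialGraph_edge_iff hG).1 hbc
  obtain ⟨hca_adj, ca_of_ac⟩ := (essentialGraph_edge_iff hG).1 hca
  have exists_ac : ∃ H ∈ triplexClass G₀, H.Arrow a c := by
    by_contra! hn
    have hca_edge : ∀ H ∈ triplexClass G₀, H.Edge c a := fun H hH => by_contra fun h =>
      hn H hH ((adj_of_adj H hH hca_adj).symm.arrow_of_not_edge h)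
    obtain ⟨G₁, hG₁, hab₁⟩ := hab.1
    have hcb₁ : G₁.Arrow c b := (adj_of_adj G₁ hG₁ hbc_adj).symm.arrow_of_not_edge fun h =>
      hG₁.1.not_reach hab₁ (h.reach.trans (hca_edge G₁ hG₁).reach)
    obtain ⟨G₂, hG₂, hbc₂⟩ := bc_of_cb ⟨G₁, hG₁, hcb₁⟩
    exact hG₂.1.not_reach hbc₂ ((hca_edge G₂ hG₂).reach.trans (hab.edge hG₂).reach)
  obtain ⟨G₂, hG₂, hca₂⟩ := ca_of_ac exists_ac
  obtain ⟨G₃, hG₃, hac₃⟩ := exists_ac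
  have hcb₂ : G₂.Arrow c b :=
    hG₂.1.arrow_trans_edge hca₂ (hab.edge hG₂) (adj_of_adj G₂ hG₂ hbc_adj).symm
  obtain ⟨G₄, hG₄, hbc₄⟩ := bc_of_cb ⟨G₂, hG₂, hcb₂⟩
  exact not_reversible_triangle (fun E => hab.arrow) (reversible_of_mem hG₃ hG₂ hac₃ hca₂)
    (reversible_of_mem hG₄ hG₂ hbc₄ hcb₂)

theorem follows_essentialGraph (hG : G ∈ triplexClass G₀) :
    Follows G (essentialGraph (triplexClass G₀)) := by
  intro x y z hxy hyz hne hn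
  have hequiv := essentialGraph_triplexEquiv hG
  refine (hequiv.symm.edge_or_line_of_unshielded hxy hyz hn hne).resolve_right ?_
  rintro ⟨-, triplex, hzy⟩
  obtain ⟨H, hH, hyz'⟩ := ((essentialGraph_edge_iff hG).1 hyz).2 ⟨G, hG, hzy⟩
  exact hyz'.2 ((triplexEquiv_of_mem hG hH).triplex_iff.1 triplex).edge_right

theorem essentialGraph_isChainGraph [Finite V] (hG : G ∈ triplexClass G₀) :
    (essentialGraph (triplexClass G₀)).IsChainGraph := by
  by_contra hnot
  obtain ⟨k, v, hv⟩ := exists_isChordlessCycle hnot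
  have walk := hv.isGeodesic.isWalk
  have essential := (essentialGraph_arrow _ _ _).1 hv.arrow
  rcases k with _ | _ | _ | k
  · exact hv.arrow.2 hv.arrow.1
  · exact hv.arrow.2 (walk 0 one_pos)
  · exact essentialGraph_not_triangle hG essential (walk 0 two_pos) (walk 1 one_lt_two)
  obtain ⟨G₁, hG₁, h₁⟩ := essential.1
  have first : G₁.Edge (v 0) (v 1) :=
    follows_essentialGraph hG₁ h₁.1 (walk 0 (by omega))
      (hv.isGeodesic.ne (i := 1) (by omega) le_rfl).symm
      fun h => hv.not_adj (by omega) le_rfl (by omega) h.symm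
  have walk₁ : IsWalk G₁.Edge (k + 3) v := fun i hi =>
    (follows_essentialGraph hG₁).edge_of_isGeodesic hv.isGeodesic
      (fun i hi => hv.not_adj (by omega) hi (by omega)) first (Nat.zero_le i) hi
  exact hG₁.1.not_reach h₁ (walk₁.reflTransGen (Nat.zero_le _) le_rfl)

theorem essentialGraph_mem [Finite V] (hG : G ∈ triplexClass G₀) :
    essentialGraph (triplexClass G₀) ∈ triplexClass G₀ :=
  ⟨essentialGraph_isChainGraph hG, (essentialGraph_triplexEquiv hG).trans hG.2⟩

/-! ### Open routes -/

/-- How the last edge of a route meets the last vertex. -/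
inductive Mark
  | head
  | line
  | tail

variable {A C : Set V} {τ : Mark}

/-- `G.OpenRoute A C y τ`: a route from a vertex of `A` arrives at `y` by an edge with mark `τ` at
`y`, such that the inner vertices at which the route has one of the forms `→ y ←`, `→ y -`, `- y ←`
are in `C`, and all others are not in `C`. A route may repeat vertices. The route of length `0`
counts as arriving with a tail. -/
inductive OpenRoute (G : MixedGraph V) (A C : Set V) : V → Mark → Prop
  | start {a : V} : a ∈ A → OpenRoute G A C a .tail
  | out {y z : V} {τ : Mark} : OpenRoute G A C y τ → G.Arrow y z → y ∉ C → OpenRoute G A C z .head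
  | line {y z : V} {τ : Mark} : OpenRoute G A C y τ → G.Line y z → (y ∈ C ↔ τ = .head) →
      OpenRoute G A C z .line
  | into {y z : V} {τ : Mark} : OpenRoute G A C y τ → G.Arrow z y → (y ∈ C ↔ τ ≠ .tail) →
      OpenRoute G A C z .tail

/-- Some open route from `A` arrives at `y` by a line or against an arrow. -/
def OpenNonhead (G : MixedGraph V) (A C : Set V) (y : V) : Prop :=
  G.OpenRoute A C y .line ∨ G.OpenRoute A C y .tail

/-- Open routes can be continued from `y` as if they had arrived there by a line. -/
def OpenAsLine (G : MixedGraph V) (A C : Set V) (y : V) : Prop :=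
  (y ∉ C → G.OpenNonhead A C y) ∧ (y ∈ C → ∀ z, G.Arrow z y → G.OpenRoute A C z .tail)

/-- Open routes can be continued from `y` as if they had arrived there against an arrow. -/
def OpenAsTail (G : MixedGraph V) (A C : Set V) (y : V) : Prop :=
  y ∉ C → G.OpenNonhead A C y ∧ ∀ z, G.Arrow z y → G.OpenRoute A C z .tail

theorem OpenNonhead.exists_openRoute (h : G.OpenNonhead A C y) : ∃ τ, G.OpenRoute A C y τ :=
  h.elim (⟨_, ·⟩) (⟨_, ·⟩)

theorem OpenNonhead.out (h : G.OpenNonhead A C y) (hyz : G.Arrow y z) (hy : y ∉ C) :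
    G.OpenRoute A C z .head :=
  h.elim (.out · hyz hy) (.out · hyz hy)

theorem OpenNonhead.line (h : G.OpenNonhead A C y) (hyz : G.Line y z) (hy : y ∉ C) :
    G.OpenRoute A C z .line :=
  h.elim (.line · hyz (by simp [hy])) (.line · hyz (by simp [hy]))

theorem OpenRoute.openAsLine (h : G.OpenRoute A C y .line) : G.OpenAsLine A C y :=
  ⟨fun _ => Or.inl h, fun hy _ hz => .into h hz (by simp [hy])⟩

theorem OpenRoute.openAsTail (h : G.OpenRoute A C y .tail) : G.OpenAsTail A C y :=
  fun hy => ⟨Or.inr h, fun _ hz => .into h hz (by simp [hy])⟩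

/-! ### Open routes of a feasible split -/

theorem split_arrow_iff :
    (G.split T).Arrow a b ↔ G.Arrow a b ∨ (a ∉ T ∧ b ∈ T ∧ G.Line a b) := by
  simp only [split, Arrow, Line]
  tauto

theorem split_line_iff : (G.split T).Line a b ↔ G.Line a b ∧ (a ∈ T ↔ b ∈ T) := by
  simp only [split, Line]
  tauto

theorem Arrow.split (h : G.Arrow a b) : (G.split T).Arrow a b := split_arrow_iff.2 (Or.inl h)

/-- The vertices outside `T` that have a line into `T`. -/
def lineBoundary (G : MixedGraph V) (T : Set V) : Set V := {q | q ∉ T ∧ ∃ t ∈ T, G.Line q t}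

namespace FeasibleSplit

variable (h : G.FeasibleSplit T)
include h

theorem line_of_mem {t : V} (hq : q ∈ G.lineBoundary T) (ht : t ∈ T) : G.Line q t := by
  obtain ⟨hqT, t', ht', hl⟩ := hq
  exact h.joined q hqT t' ht' hl t ht

theorem line_of_ne (hp : p ∈ G.lineBoundary T) (hq : q ∈ G.lineBoundary T) (hne : p ≠ q) :
    G.Line p q := by
  obtain ⟨hpT, t, ht, hl⟩ := hp
  exact h.complete p hpT q hq.1 t ht hl (h.line_of_mem hq ht) hne

theorem arrow_of_arrow {t : V} (hq : q ∈ G.lineBoundary T) (hp : G.Arrow p q) (ht : t ∈ T) :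
    G.Arrow p t :=
  h.parents p q hq.1 t ht hp (h.line_of_mem hq ht)

theorem split_arrow {t : V} (hq : q ∈ G.lineBoundary T) (ht : t ∈ T) : (G.split T).Arrow q t :=
  split_arrow_iff.2 (Or.inr ⟨hq.1, ht, h.line_of_mem hq ht⟩)

end FeasibleSplit

/-- What an open route of `G.split T` to `y` with mark `τ` tells about open routes of `G`. -/
def UnsplitInv (G : MixedGraph V) (A C T : Set V) (y : V) : Mark → Prop
  | .head =>
      (G.OpenRoute A C y .head ∨ (y ∈ T ∧ ∃ q ∈ G.lineBoundary T, q ∉ C ∧ G.OpenNonhead A C q)) ∧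
      (y ∈ G.lineBoundary T → ∀ t ∈ T, G.OpenRoute A C t .head)
  | .line => G.OpenRoute A C y .line ∧ (y ∈ T → ∀ q ∈ G.lineBoundary T, G.OpenNonhead A C q)
  | .tail => G.OpenAsTail A C y

namespace UnsplitInv

theorem exists_openRoute (h : G.FeasibleSplit T) (inv : UnsplitInv G A C T y τ) (hy : y ∉ C) :
    ∃ τ, G.OpenRoute A C y τ := by
  cases τ with
  | head =>
    rcases inv.1 with ho | ⟨hyT, q, hq, hqC, ho⟩
    · exact ⟨_, ho⟩
    · exact ⟨_, ho.line (h.line_of_mem hq hyT) hqC⟩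
  | line => exact ⟨_, inv.1⟩
  | tail => exact (inv hy).1.exists_openRoute

theorem out (h : G.FeasibleSplit T) (inv : UnsplitInv G A C T y τ)
    (hyz : (G.split T).Arrow y z) (hy : y ∉ C) : UnsplitInv G A C T z .head := by
  rcases split_arrow_iff.1 hyz with hyz | ⟨hyT, hzT, hyz⟩
  · obtain ⟨_, ho⟩ := inv.exists_openRoute h hy
    exact ⟨Or.inl (.out ho hyz hy), fun hz t ht => .out ho (h.arrow_of_arrow hz hyz ht) hy⟩
  · have hyB : y ∈ G.lineBoundary T := ⟨hyT, z, hzT, hyz⟩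
    refine ⟨?_, fun hz => absurd hzT hz.1⟩
    cases τ with
    | head => exact Or.inl (inv.2 hyB z hzT)
    | line => exact Or.inr ⟨hzT, y, hyB, hy, Or.inl inv.1⟩
    | tail => exact Or.inr ⟨hzT, y, hyB, hy, (inv hy).1⟩

theorem openRoute_or_exists_lineBoundary (inv : UnsplitInv G A C T y τ)
    (hy : y ∈ C ↔ τ = .head) :
    (∃ τ', G.OpenRoute A C y τ' ∧ (y ∈ C ↔ τ' = .head)) ∨
      (y ∈ T ∧ ∃ q ∈ G.lineBoundary T, q ∉ C ∧ G.OpenNonhead A C q) := by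
  cases τ with
  | head => exact inv.1.imp_left fun ho => ⟨_, ho, hy⟩
  | line => exact Or.inl ⟨_, inv.1, hy⟩
  | tail =>
    have hyC : y ∉ C := by simpa using hy
    exact Or.inl ((inv hyC).1.elim (⟨_, ·, by simp [hyC]⟩) (⟨_, ·, by simp [hyC]⟩))

theorem line (h : G.FeasibleSplit T) (inv : UnsplitInv G A C T y τ)
    (hyz : (G.split T).Line y z) (hy : y ∈ C ↔ τ = .head) : UnsplitInv G A C T z .line := by
  obtain ⟨hyz, hT⟩ := split_line_iff.1 hyz
  rcases inv.openRoute_or_exists_lineBoundary hy with ⟨τ', ho, hy⟩ | ⟨hyT, q, hq, hqC, ho⟩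
  · exact ⟨.line ho hyz hy, fun hzT q hq =>
      Or.inl (.line ho (h.line_of_mem hq (hT.2 hzT)).symm hy)⟩
  · refine ⟨ho.line (h.line_of_mem hq (hT.1 hyT)) hqC, fun _ q' hq' => ?_⟩
    by_cases hne : q = q'
    · exact hne ▸ ho
    · exact Or.inl (ho.line (h.line_of_ne hq hq' hne) hqC)

theorem openRoute_of_arrow (h : G.FeasibleSplit T) (inv : UnsplitInv G A C T y τ)
    (hzy : G.Arrow z y) (hy : y ∈ C ↔ τ ≠ .tail) : G.OpenRoute A C z .tail := by
  cases τ with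
  | head =>
    rcases inv.1 with ho | ⟨hyT, q, hq, hqC, ho⟩
    · exact .into ho hzy hy
    · exact .into (ho.line (h.line_of_mem hq hyT) hqC) hzy (by simpa using hy)
  | line => exact .into inv.1 hzy hy
  | tail => exact (inv (by simpa using hy)).2 z hzy

theorem openNonhead_of_line (h : G.FeasibleSplit T) (inv : UnsplitInv G A C T y τ)
    (hz : z ∈ G.lineBoundary T) (hyT : y ∈ T) (hy : y ∈ C ↔ τ ≠ .tail) : G.OpenNonhead A C z := by
  have hyz : G.Line y z := (h.line_of_mem hz hyT).symm
  cases τ with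
  | head =>
    rcases inv.1 with ho | ⟨-, q, hq, hqC, ho⟩
    · exact Or.inl (.line ho hyz (by simpa using hy))
    · by_cases hne : q = z
      · exact hne ▸ ho
      · exact Or.inl (ho.line (h.line_of_ne hq hz hne) hqC)
  | line => exact inv.2 hyT z hz
  | tail =>
    have hyC : y ∉ C := by simpa using hy
    exact Or.inl ((inv hyC).1.line hyz hyC)

theorem into (h : G.FeasibleSplit T) (inv : UnsplitInv G A C T y τ)
    (hzy : (G.split T).Arrow z y) (hy : y ∈ C ↔ τ ≠ .tail) : UnsplitInv G A C T z .tail := by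
  rcases split_arrow_iff.1 hzy with hzy | ⟨hzT, hyT, hzy⟩
  · exact (inv.openRoute_of_arrow h hzy hy).openAsTail
  · have hz : z ∈ G.lineBoundary T := ⟨hzT, y, hyT, hzy⟩
    exact fun _ => ⟨inv.openNonhead_of_line h hz hyT hy, fun p hp =>
      inv.openRoute_of_arrow h (h.arrow_of_arrow hz hp hyT) hy⟩

end UnsplitInv

theorem FeasibleSplit.unsplitInv (h : G.FeasibleSplit T) (ho : (G.split T).OpenRoute A C y τ) :
    UnsplitInv G A C T y τ := by
  induction ho with
  | start ha => exact (OpenRoute.start ha).openAsTail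
  | out _ hyz hy ih => exact ih.out h hyz hy
  | line _ hyz hy ih => exact ih.line h hyz hy
  | into _ hyz hy ih => exact ih.into h hyz hy

/-- What an open route of `G` to `y` with mark `τ` tells about open routes of `G.split T`. -/
def SplitInv (G : MixedGraph V) (A C T : Set V) (y : V) : Mark → Prop
  | .head => (G.split T).OpenRoute A C y .head ∧
      (y ∈ G.lineBoundary T → ∀ t ∈ T, (G.split T).OpenRoute A C t .head)
  | .line => (y ∉ T → (G.split T).OpenAsLine A C y) ∧
      (y ∈ T → (∀ q ∈ G.lineBoundary T, (G.split T).OpenAsLine A C q) ∧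
        ((G.split T).OpenAsLine A C y ∨ ∀ t ∈ T, (G.split T).OpenRoute A C t .head))
  | .tail => (G.split T).OpenRoute A C y .tail

/-- A vertex of `T` that may be left against arrows serves for all of the boundary. -/
theorem FeasibleSplit.openAsLine {t : V} (h : G.FeasibleSplit T) (hq : q ∈ G.lineBoundary T)
    (ht : t ∈ T) (ho : ∀ z, (G.split T).Arrow z t → (G.split T).OpenRoute A C z .tail) :
    (G.split T).OpenAsLine A C q := by
  refine ⟨fun _ => Or.inr (ho q (h.split_arrow hq ht)), fun _ z hz => ho z ?_⟩
  rcases split_arrow_iff.1 hz with hz | ⟨-, hqT, -⟩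
  · exact (h.arrow_of_arrow hq hz ht).split
  · exact absurd hqT hq.1

theorem FeasibleSplit.openAsLine_of_ne (h : G.FeasibleSplit T) (hp : p ∈ G.lineBoundary T)
    (hq : q ∈ G.lineBoundary T) (hpq : p = q → (G.split T).OpenAsLine A C p)
    (ho : ∀ z, (G.split T).Line p z → (G.split T).OpenRoute A C z .line) :
    (G.split T).OpenAsLine A C q := by
  by_cases hne : p = q
  · exact hne ▸ hpq hne
  · exact (ho q (split_line_iff.2 ⟨h.line_of_ne hp hq hne, by simp [hp.1, hq.1]⟩)).openAsLine

namespace SplitInv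

theorem exists_openRoute (inv : SplitInv G A C T y τ) (hy : y ∉ C) :
    ∃ τ, (G.split T).OpenRoute A C y τ := by
  cases τ with
  | head => exact ⟨_, inv.1⟩
  | line =>
    by_cases hyT : y ∈ T
    · exact (inv.2 hyT).2.elim (fun ho => (ho.1 hy).exists_openRoute) fun ho => ⟨_, ho y hyT⟩
    · exact ((inv.1 hyT).1 hy).exists_openRoute
  | tail => exact ⟨_, inv⟩

theorem out (h : G.FeasibleSplit T) (inv : SplitInv G A C T y τ) (hyz : G.Arrow y z)
    (hy : y ∉ C) : SplitInv G A C T z .head := by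
  obtain ⟨_, ho⟩ := inv.exists_openRoute hy
  exact ⟨.out ho hyz.split hy, fun hz t ht => .out ho (h.arrow_of_arrow hz hyz ht).split hy⟩

theorem openNonhead (inv : SplitInv G A C T y τ) (hyT : y ∉ T) (hy : y ∉ C) (hτ : τ ≠ .head) :
    (G.split T).OpenNonhead A C y := by
  cases τ with
  | head => exact absurd rfl hτ
  | line => exact (inv.1 hyT).1 hy
  | tail => exact Or.inr inv

theorem line_of_mem (h : G.FeasibleSplit T) (inv : SplitInv G A C T y τ) (hyz : G.Line y z)
    (hy : y ∈ C ↔ τ = .head) (hyT : y ∈ T) : SplitInv G A C T z .line := by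
  have boundary : ∀ q ∈ G.lineBoundary T, (G.split T).OpenAsLine A C q := by
    cases τ with
    | head =>
      exact fun q hq => h.openAsLine hq hyT fun z hz => .into inv.1 hz (by simpa using hy)
    | line => exact (inv.2 hyT).1
    | tail => exact fun q hq => h.openAsLine hq hyT fun z hz => .into inv hz (by simpa using hy)
  refine ⟨fun hzT => boundary z ⟨hzT, y, hyT, hyz.symm⟩, fun hzT => ⟨boundary, ?_⟩⟩
  have hyz' : (G.split T).Line y z := split_line_iff.2 ⟨hyz, by simp [hyT, hzT]⟩
  cases τ with
  | head => exact Or.inl (OpenRoute.line inv.1 hyz' hy).openAsLine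
  | line =>
    have hyC : y ∉ C := by simpa using hy
    exact (inv.2 hyT).2.imp_left fun ho => ((ho.1 hyC).line hyz' hyC).openAsLine
  | tail => exact Or.inl (OpenRoute.line inv hyz' hy).openAsLine

theorem line_of_lineBoundary (h : G.FeasibleSplit T) (inv : SplitInv G A C T y τ)
    (hy : y ∈ C ↔ τ = .head) (hyB : y ∈ G.lineBoundary T) (hzT : z ∈ T) :
    SplitInv G A C T z .line := by
  refine ⟨fun h => absurd hzT h, fun _ => ?_⟩
  by_cases hτ : τ = .head
  · subst hτ
    have hyC : y ∈ C := hy.2 rfl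
    refine ⟨fun q hq => h.openAsLine_of_ne hyB hq (fun _ => ⟨fun hn => absurd hyC hn, ?_⟩)
      fun z hz => .line inv.1 hz hy, Or.inr (inv.2 hyB)⟩
    exact fun _ z hz => .into inv.1 hz (by simp [hyC])
  · have hyC : y ∉ C := mt hy.1 hτ
    have ho := inv.openNonhead hyB.1 hyC hτ
    exact ⟨fun q hq => h.openAsLine_of_ne hyB hq (fun _ => ⟨fun _ => ho, fun hn => absurd hn hyC⟩)
      fun z hz => ho.line hz hyC, Or.inr fun t ht => ho.out (h.split_arrow hyB ht) hyC⟩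

theorem line_of_not_mem (inv : SplitInv G A C T y τ) (hyz : G.Line y z) (hy : y ∈ C ↔ τ = .head)
    (hyT : y ∉ T) (hzT : z ∉ T) : SplitInv G A C T z .line := by
  have hyz' : (G.split T).Line y z := split_line_iff.2 ⟨hyz, by simp [hyT, hzT]⟩
  refine ⟨fun _ => OpenRoute.openAsLine ?_, fun h => absurd h hzT⟩
  by_cases hτ : τ = .head
  · subst hτ
    exact .line inv.1 hyz' hy
  · exact (inv.openNonhead hyT (mt hy.1 hτ) hτ).line hyz' (mt hy.1 hτ)

theorem line (h : G.FeasibleSplit T) (inv : SplitInv G A C T y τ) (hyz : G.Line y z)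
    (hy : y ∈ C ↔ τ = .head) : SplitInv G A C T z .line := by
  by_cases hyT : y ∈ T
  · exact inv.line_of_mem h hyz hy hyT
  · by_cases hzT : z ∈ T
    · exact inv.line_of_lineBoundary h hy ⟨hyT, z, hzT, hyz⟩ hzT
    · exact inv.line_of_not_mem hyz hy hyT hzT

theorem into (inv : SplitInv G A C T y τ) (hzy : G.Arrow z y) (hy : y ∈ C ↔ τ ≠ .tail) :
    (G.split T).OpenRoute A C z .tail := by
  cases τ with
  | head => exact .into inv.1 hzy.split hy
  | line =>
    have hyC : y ∈ C := by simpa using hy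
    by_cases hyT : y ∈ T
    · rcases (inv.2 hyT).2 with ho | ho
      · exact ho.2 hyC z hzy.split
      · exact .into (ho y hyT) hzy.split (by simpa using hy)
    · exact (inv.1 hyT).2 hyC z hzy.split
  | tail => exact .into inv hzy.split hy

end SplitInv

theorem FeasibleSplit.splitInv (h : G.FeasibleSplit T) (ho : G.OpenRoute A C y τ) :
    SplitInv G A C T y τ := by
  induction ho with
  | start ha => exact .start ha
  | out _ hyz hy ih => exact ih.out h hyz hy
  | line _ hyz hy ih => exact ih.line h hyz hy
  | into _ hyz hy ih => exact ih.into hyz hy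

/-! ### Route equivalence of triplex equivalent graphs -/

/-- Some vertex of `B` is at the end of an open route from `A`. -/
def Connects (G : MixedGraph V) (A B C : Set V) : Prop := ∃ b ∈ B, ∃ τ, G.OpenRoute A C b τ

/-- `G` and `H` have open routes between the same sets of vertices. -/
def RouteEquiv (G H : MixedGraph V) : Prop :=
  ∀ A B C : Set V, Disjoint B C → (G.Connects A B C ↔ H.Connects A B C)

theorem RouteEquiv.refl (G : MixedGraph V) : RouteEquiv G G := fun _ _ _ _ => Iff.rfl

theorem RouteEquiv.symm (h : RouteEquiv G H) : RouteEquiv H G :=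
  fun A B C hBC => (h A B C hBC).symm

theorem RouteEquiv.trans (h : RouteEquiv G H) (h' : RouteEquiv H K) : RouteEquiv G K :=
  fun A B C hBC => (h A B C hBC).trans (h' A B C hBC)

theorem FeasibleSplit.routeEquiv (h : G.FeasibleSplit T) : RouteEquiv (G.split T) G := by
  intro A B C hBC
  constructor
  · rintro ⟨b, hb, τ, ho⟩
    exact ⟨b, hb, (h.unsplitInv ho).exists_openRoute h (Set.disjoint_left.1 hBC hb)⟩
  · rintro ⟨b, hb, τ, ho⟩
    exact ⟨b, hb, (h.splitInv ho).exists_openRoute (Set.disjoint_left.1 hBC hb)⟩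

theorem Covered.routeEquiv (h : G.Covered v w) : RouteEquiv (G.flip v w h.ne) G := by
  have right := h.feasibleSplit_right.routeEquiv
  have left := h.feasibleSplit_left.routeEquiv
  rw [h.merge_split_right] at right
  rw [h.merge_split_left] at left
  exact left.trans right.symm

namespace IsMaxOriented

theorem edge_of_not_reversed (hD : IsMaxOriented G₀ D) (hE : IsMaxOriented G₀ E)
    (hne : ¬ ∃ v w, D.Arrow v w ∧ E.Arrow w v) (hab : D.Edge a b) : E.Edge a b := by
  by_cases hba : D.Edge b a
  · exact ((hD.line_iff hE).1 ⟨hab, hba⟩).1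
  · exact ((hD.arrow_or_arrow hE ⟨hab, hba⟩).resolve_right fun h => hne ⟨a, b, ⟨hab, hba⟩, h⟩).1

theorem eq_of_not_reversed (hD : IsMaxOriented G₀ D) (hE : IsMaxOriented G₀ E)
    (hne : ¬ ∃ v w, D.Arrow v w ∧ E.Arrow w v) : D = E := by
  ext a b
  exact ⟨hD.edge_of_not_reversed hE hne,
    hE.edge_of_not_reversed hD fun ⟨v, w, h, h'⟩ => hne ⟨w, v, h', h⟩⟩

theorem routeEquiv [Finite V] (hD : IsMaxOriented G₀ D) (hE : IsMaxOriented G₀ E) :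
    RouteEquiv D E := by
  obtain ⟨F, ⟨hF, hDF⟩, hmin⟩ := Set.exists_min_image
    {F | IsMaxOriented G₀ F ∧ RouteEquiv D F} (fun F => (reversedArrows F E).ncard)
    (Set.toFinite _) ⟨D, hD, .refl D⟩
  suffices F = E from this ▸ hDF
  refine hF.eq_of_not_reversed hE fun ⟨v, w, hvw, hwv⟩ => ?_
  obtain ⟨v, w, hcov, hwv, -⟩ := exists_covered hF hE (T := Set.univ) (fun _ _ _ _ => trivial)
    ⟨v, w, hvw, hwv, trivial⟩
  exact (hmin _ ⟨hcov.isMaxOriented_flip hF, hDF.trans hcov.routeEquiv.symm⟩).not_gt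
    (Set.ncard_lt_ncard (hcov.reversedArrows_flip_ssubset hwv) (Set.toFinite _))

end IsMaxOriented

theorem mem_coherent_singleton : a ∈ D.coherent {b} ↔ Relation.ReflTransGen D.Line a b := by
  simp [coherent]

theorem ant_eq_of_mem_coherent (h : a ∈ D.coherent {b}) : D.ant a = D.ant b := by
  induction mem_coherent_singleton.1 h using Relation.ReflTransGen.head_induction_on with
  | refl => rfl
  | head hxy hyb ih =>
    rw [← ih (mem_coherent_singleton.2 hyb)]
    ext z
    exact ⟨fun h => Reach.trans h hxy.1.reach, fun h => Reach.trans h hxy.2.reach⟩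

theorem TriplexEquiv.line_of_arrow (h : TriplexEquiv G D) (hG : G.IsChainGraph)
    (hab : G.Line a b) (hcb : G.Line c b) (hab' : D.Arrow a b) (hcb' : D.Edge c b) (hne : a ≠ c) :
    G.Line a c := by
  refine hG.line_trans hab hcb.symm ?_
  by_contra hn
  have triplex : G.Triplex a b c :=
    h.triplex_iff.2 ⟨hne, mt h.adj_iff.2 hn, hab'.1, hcb', Or.inl hab'⟩
  exact triplex.arrow.elim (fun h => h.2 hab.2) fun h => h.2 hcb.2

theorem IsMaxOriented.feasibleSplit {t : V} (hD : IsMaxOriented G₀ D) (hG : G ∈ triplexClass G₀)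
    (hT : ∀ q ∉ D.coherent {t}, ∀ u ∈ D.coherent {t}, G.Line q u → D.Arrow q u) :
    G.FeasibleSplit (D.coherent {t}) := by
  have hequiv := triplexEquiv_of_mem hG hD.mem
  refine ⟨?_, fun q hq q' hq' u hu hl hl' hne => ?_, fun p q hq u hu hp hl => ?_⟩
  · have : Std.Symm D.Line := ⟨fun _ _ => Line.symm⟩
    intro q hq u hu hl u' hu'
    have path : Relation.ReflTransGen D.Line u u' :=
      (mem_coherent_singleton.1 hu).trans (symm (mem_coherent_singleton.1 hu'))
    induction path using Relation.ReflTransGen.head_induction_on with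
    | refl => exact hl
    | @head x y hxy _ ih =>
      have hqx := hT q hq x hu hl
      have hqy : q ≠ y := by
        rintro rfl
        exact hqx.2 hxy.1
      have hyt := mem_coherent_singleton.2 (.head hxy.symm (mem_coherent_singleton.1 hu))
      exact ih hyt (hequiv.line_of_arrow hG.1 hl (hD.line_of_line hxy.symm G hG) hqx hxy.2 hqy)
  · exact hequiv.line_of_arrow hG.1 hl hl' (hT q hq u hu hl) (hT q' hq' u hu hl').1 hne
  · have hpu : p ≠ u := by
      rintro rfl
      exact hp.2 hl.1
    refine hG.1.arrow_trans_edge hp hl.1 ?_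
    by_contra hn
    exact (hT q hq u hu hl).2
      (hequiv.triplex_iff.1 ⟨hpu, hn, hp.1, hl.2, Or.inl hp⟩).edge_right

/-- A member of the class that has a line which is not a line in all members can be split: the
tail set is a chain component of `D` with the largest anterior set among those into which a line
of `G` is oriented in `D`. -/
theorem IsMaxOriented.exists_feasibleSplit [Finite V] (hD : IsMaxOriented G₀ D)
    (hG : G ∈ triplexClass G₀) (hab : G.Line a b) (hab' : D.Arrow a b) :
    ∃ T, G.FeasibleSplit T ∧ ∃ q ∉ T, ∃ t ∈ T, G.Line q t := by
  obtain ⟨t, ⟨u, hut, hut'⟩, hmax⟩ := Set.exists_max_image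
    {t | ∃ u, G.Line u t ∧ D.Arrow u t} (fun t => (D.ant t).ncard) (Set.toFinite _)
    ⟨b, a, hab, hab'⟩
  have ncard_lt : ∀ {x y}, D.Arrow x y → (D.ant x).ncard < (D.ant y).ncard := fun h =>
    Set.ncard_lt_ncard (hD.isChainGraph.ant_ssubset h) (Set.toFinite _)
  refine ⟨D.coherent {t}, hD.feasibleSplit hG fun q hq t' ht' hl => ?_, u, fun hu => ?_,
    t, ⟨t, rfl, .refl⟩, hut⟩
  · rcases adj_iff_arrow_or_line.1 ((triplexEquiv_of_mem hG hD.mem).adj_iff.1 hl.adj) with h | h | h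
    · exact h
    · exact absurd (mem_coherent_singleton.2 (.head h (mem_coherent_singleton.1 ht'))) hq
    · exact absurd (ant_eq_of_mem_coherent ht' ▸ ncard_lt h)
        (hmax q ⟨t', hl.symm, h⟩).not_gt
  · exact absurd (ncard_lt hut') (by rw [ant_eq_of_mem_coherent hu]; exact lt_irrefl _)

theorem isMaxOriented_of_forall_not_feasibleSplit [Finite V] (hG : G ∈ triplexClass G₀)
    (hsplit : ∀ T, G.FeasibleSplit T → ∀ q ∉ T, ∀ t ∈ T, ¬ G.Line q t) : IsMaxOriented G₀ G := by
  obtain ⟨D, hD⟩ := exists_isMaxOriented hG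
  have not_arrow : ∀ {a b}, G.Line a b → ¬ D.Arrow a b := fun hab hab' => by
    obtain ⟨T, hT, q, hq, t, ht, hqt⟩ := hD.exists_feasibleSplit hG hab hab'
    exact hsplit T hT q hq t ht hqt
  refine ⟨hG.1, hG.2, fun {a b} hab => hD.line_of_line ?_⟩
  exact ((adj_iff_arrow_or_line.1 ((triplexEquiv_of_mem hG hD.mem).adj_iff.1
    hab.adj)).resolve_left (not_arrow hab)).resolve_right (not_arrow hab.symm)

theorem exists_isMaxOriented_routeEquiv [Finite V] (hG : G ∈ triplexClass G₀) :
    ∃ D, IsMaxOriented G₀ D ∧ RouteEquiv G D := by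
  obtain ⟨D, ⟨hD, hGD⟩, hmin⟩ := Set.exists_min_image
    {D | D ∈ triplexClass G₀ ∧ RouteEquiv G D} (fun D => {e : V × V | D.Edge e.1 e.2}.ncard)
    (Set.toFinite _) ⟨G, hG, .refl G⟩
  refine ⟨D, isMaxOriented_of_forall_not_feasibleSplit hD fun T hT q hq t ht hqt => ?_, hGD⟩
  refine (hmin _ ⟨hT.mem hD, hGD.trans hT.routeEquiv.symm⟩).not_gt
    (Set.ncard_lt_ncard ?_ (Set.toFinite _))
  exact (Set.ssubset_iff_of_subset fun e h => h.1).2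
    ⟨(t, q), hqt.2, fun h => h.2 ⟨ht, hq, hqt.1⟩⟩

theorem routeEquiv_of_mem [Finite V] (hG : G ∈ triplexClass G₀) (hH : H ∈ triplexClass G₀) :
    RouteEquiv G H := by
  obtain ⟨D, hD, hGD⟩ := exists_isMaxOriented_routeEquiv hG
  obtain ⟨E, hE, hHE⟩ := exists_isMaxOriented_routeEquiv hH
  exact hGD.trans ((hD.routeEquiv hE).trans hHE.symm)

/-! ### Separation in the augmented graph -/

variable {B S : Set V}

theorem subset_ancestors : S ⊆ G.ancestors S := fun a ha => ⟨a, ha, .refl⟩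

theorem subset_coherent : S ⊆ G.coherent S := fun a ha => ⟨a, ha, .refl⟩

theorem Arrow.mem_ancestors (h : G.Arrow a b) (hb : b ∈ G.ancestors S) : a ∈ G.ancestors S :=
  hb.imp fun _ hs => hs.imp_right (.head h)

theorem Line.mem_coherent (h : G.Line a b) (hb : b ∈ G.coherent S) : a ∈ G.coherent S :=
  hb.imp fun _ hs => hs.imp_right (.head h)

theorem extended_arrow_iff : (G.extended S).Arrow a b ↔ G.Arrow a b ∧ b ∈ G.ancestors S := by
  constructor
  · rintro ⟨⟨hab, ha, hb⟩ | ⟨hab, ha, hb⟩, hn⟩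
    · exact ⟨⟨hab, fun hba => hn (Or.inl ⟨hba, hb, ha⟩)⟩, hb⟩
    · exact absurd (Or.inr ⟨hab.symm, hb, ha⟩) hn
  · rintro ⟨hab, hb⟩
    refine ⟨Or.inl ⟨hab.1, hab.mem_ancestors hb, hb⟩, ?_⟩
    rintro (⟨hba, -⟩ | ⟨hba, -⟩)
    · exact hab.2 hba
    · exact hab.2 hba.1

theorem extended_line_iff :
    (G.extended S).Line a b ↔ G.Line a b ∧ a ∈ G.coherent (G.ancestors S) := by
  constructor
  · rintro ⟨⟨hab, ha, -⟩ | ⟨hab, ha, -⟩, hba⟩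
    · exact ⟨⟨hab, hba.elim And.left fun hba => hba.1.1⟩, subset_coherent ha⟩
    · exact ⟨hab, ha⟩
  · rintro ⟨hab, ha⟩
    have hb := hab.symm.mem_coherent ha
    exact ⟨Or.inr ⟨hab, ha, hb⟩, Or.inr ⟨hab.symm, hb, ha⟩⟩

theorem adj_of_extended (h : (G.extended S).Adj a b) : G.Adj a b := by
  rcases adj_iff_arrow_or_line.1 h with h | h | h
  · exact (extended_arrow_iff.1 h).1.adj
  · exact (extended_line_iff.1 h).1.adj
  · exact (extended_arrow_iff.1 h).1.adj.symm

theorem augmented_adj_iff : H.augmented.Adj a b ↔ a ≠ b ∧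
    (H.Adj a b ∨ (∃ c, H.Triplex a c b) ∨ ∃ c d, H.Biflag a b c d) := by
  rw [augmented, SimpleGraph.fromRel_adj]
  refine and_congr_right fun _ => ⟨?_, Or.inl⟩
  rintro (h | h | ⟨c, h⟩ | ⟨c, d, hbc, hcd, had, hbd, hac⟩)
  · exact h
  · exact Or.inl h.symm
  · exact Or.inr (Or.inl ⟨c, h.symm⟩)
  · exact Or.inr (Or.inr ⟨d, c, had, hcd.symm, hbc, hac, hbd⟩)

theorem Adj.augmented (h : H.Adj a b) : H.augmented.Adj a b :=
  augmented_adj_iff.2 ⟨h.ne, Or.inl h⟩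

theorem eq_or_augmented_adj (hab : H.Edge a b) (hcb : H.Edge c b)
    (h : H.Arrow a b ∨ H.Arrow c b) : a = c ∨ H.augmented.Adj a c := by
  by_cases hne : a = c
  · exact Or.inl hne
  by_cases hac : H.Adj a c
  · exact Or.inr hac.augmented
  · exact Or.inr (augmented_adj_iff.2 ⟨hne, Or.inr (Or.inl ⟨b, hne, hac, hab, hcb, h⟩)⟩)

theorem IsChainGraph.eq_or_extended_augmented_adj (hG : G.IsChainGraph)
    (hab : (G.extended S).Arrow a b) (hbc : (G.extended S).Line b c)
    (hpc : (G.extended S).Arrow p c) : a = p ∨ (G.extended S).augmented.Adj a p := by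
  obtain ⟨hab', hb⟩ := extended_arrow_iff.1 hab
  obtain ⟨hpc', hc⟩ := extended_arrow_iff.1 hpc
  have hbc' := (extended_line_iff.1 hbc).1
  by_cases hac : (G.extended S).Adj a c
  · have hac' :=
      extended_arrow_iff.2 ⟨hG.arrow_trans_edge hab' hbc'.1 (adj_of_extended hac), hc⟩
    exact eq_or_augmented_adj hac'.1 hpc.1 (Or.inl hac')
  by_cases hpb : (G.extended S).Adj p b
  · have hpb' :=
      extended_arrow_iff.2 ⟨hG.arrow_trans_edge hpc' hbc'.2 (adj_of_extended hpb), hb⟩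
    exact eq_or_augmented_adj hab.1 hpb'.1 (Or.inl hab)
  by_cases hne : a = p
  · exact Or.inl hne
  · exact Or.inr (augmented_adj_iff.2 ⟨hne, Or.inr (Or.inr ⟨b, c, hab, hbc, hpc, hac, hpb⟩)⟩)

/-- Follow the arrows down from `w` to `A ∪ B ∪ C`: in `A` a new route starts, in `B` the route
ends, and in `C` it turns back. -/
theorem OpenRoute.tail_of_mem_ancestors (h : G.OpenRoute A C w τ) (hw : w ∉ C)
    (han : w ∈ G.ancestors (A ∪ B ∪ C)) : G.Connects A B C ∨ G.OpenRoute A C w .tail := by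
  obtain ⟨s, hs, hws⟩ := han
  induction hws using Relation.ReflTransGen.head_induction_on generalizing τ with
  | refl =>
    rcases hs with (hs | hs) | hs
    · exact Or.inr (.start hs)
    · exact Or.inl ⟨s, hs, τ, h⟩
    · exact absurd hs hw
  | @head w y hwy _ ih =>
    have hy' := OpenRoute.out h hwy hw
    by_cases hy : y ∈ C
    · exact Or.inr (.into hy' hwy (by simp [hy]))
    · exact (ih hy' hy).imp_right fun h => .into h hwy (by simp [hy])

/-- A vertex at which an open route arrives that can be continued along every edge of the
extended subgraph. -/
def Flexible (G : MixedGraph V) (A B C : Set V) (w : V) : Prop :=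
  G.OpenRoute A C w .tail ∨ (G.OpenRoute A C w .line ∧ w ∉ G.ancestors (A ∪ B ∪ C))

theorem OpenRoute.flexible (h : G.OpenRoute A C w τ) (hw : w ∉ C)
    (hτ : τ = .head → w ∈ G.ancestors (A ∪ B ∪ C)) :
    G.Connects A B C ∨ G.Flexible A B C w := by
  by_cases han : w ∈ G.ancestors (A ∪ B ∪ C)
  · exact (h.tail_of_mem_ancestors hw han).imp_right Or.inl
  · cases τ with
    | head => exact absurd (hτ rfl) han
    | line => exact Or.inr (Or.inr ⟨h, han⟩)
    | tail => exact Or.inr (Or.inl h)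

theorem OpenRoute.into_of_head_or_line (h : G.OpenRoute A C y τ) (hτ : τ ≠ .tail)
    (han : y ∈ G.ancestors (A ∪ B ∪ C)) (hzy : G.Arrow z y) :
    G.Connects A B C ∨ G.OpenRoute A C z .tail := by
  by_cases hy : y ∈ C
  · exact Or.inr (.into h hzy (by simp [hy, hτ]))
  · exact (h.tail_of_mem_ancestors hy han).imp_right fun h => .into h hzy (by simp [hy])

theorem OpenRoute.line_of_head (h : G.OpenRoute A C y .head) (han : y ∈ G.ancestors (A ∪ B ∪ C))
    (hyz : G.Line y z) : G.Connects A B C ∨ G.OpenRoute A C z .line := by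
  by_cases hy : y ∈ C
  · exact Or.inr (.line h hyz (by simp [hy]))
  · exact (h.tail_of_mem_ancestors hy han).imp_right fun h => .line h hyz (by simp [hy])

namespace Flexible

theorem connects (h : G.Flexible A B C b) (hb : b ∈ B) : G.Connects A B C :=
  h.elim (⟨b, hb, _, ·⟩) fun h => ⟨b, hb, _, h.1⟩

theorem line (h : G.Flexible A B C w) (hw : w ∉ C) (hwz : G.Line w z) :
    G.OpenRoute A C z .line :=
  h.elim (.line · hwz (by simp [hw])) fun h => .line h.1 hwz (by simp [hw])

theorem tail (h : G.Flexible A B C w) (han : w ∈ G.ancestors (A ∪ B ∪ C)) :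
    G.OpenRoute A C w .tail :=
  h.resolve_right fun h => h.2 han

theorem out (h : G.Flexible A B C w) (hw : w ∉ C)
    (hwz : (G.extended (A ∪ B ∪ C)).Arrow w z) :
    G.OpenRoute A C z .head ∧ z ∈ G.ancestors (A ∪ B ∪ C) := by
  obtain ⟨hwz, hz⟩ := extended_arrow_iff.1 hwz
  exact ⟨.out (h.tail (hwz.mem_ancestors hz)) hwz hw, hz⟩

theorem of_adj (h : G.Flexible A B C w) (hw : w ∉ C) (hz : z ∉ C)
    (hwz : (G.extended (A ∪ B ∪ C)).Adj w z) : G.Connects A B C ∨ G.Flexible A B C z := by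
  rcases adj_iff_arrow_or_line.1 hwz with hwz | hwz | hzw
  · obtain ⟨ho, han⟩ := h.out hw hwz
    exact ho.flexible hz fun _ => han
  · exact (h.line hw (extended_line_iff.1 hwz).1).flexible hz (by simp)
  · obtain ⟨hzw, han⟩ := extended_arrow_iff.1 hzw
    exact Or.inr (Or.inl (.into (h.tail han) hzw (by simp [hw])))

theorem of_triplex (h : G.Flexible A B C w) (hw : w ∉ C) (hz : z ∉ C)
    (ht : (G.extended (A ∪ B ∪ C)).Triplex w y z) :
    G.Connects A B C ∨ G.Flexible A B C z := by
  by_cases hyw : (G.extended (A ∪ B ∪ C)).Edge y w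
  · have hwy := (extended_line_iff.1 ⟨ht.edge_left, hyw⟩).1
    obtain ⟨hzy, han⟩ := extended_arrow_iff.1 (ht.arrow.resolve_left fun h => h.2 hyw)
    exact ((h.line hw hwy).into_of_head_or_line (by simp) han hzy).imp_right Or.inl
  · obtain ⟨ho, han⟩ := h.out hw ⟨ht.edge_left, hyw⟩
    by_cases hyz : (G.extended (A ∪ B ∪ C)).Edge y z
    · rcases ho.line_of_head han (extended_line_iff.1 ⟨hyz, ht.edge_right⟩).1 with hc | ho
      · exact Or.inl hc
      · exact ho.flexible hz (by simp)
    · have hzy := (extended_arrow_iff.1 ⟨ht.edge_right, hyz⟩).1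
      exact (ho.into_of_head_or_line (by simp) han hzy).imp_right Or.inl

theorem of_biflag (h : G.Flexible A B C w) (hw : w ∉ C)
    (hb : (G.extended (A ∪ B ∪ C)).Biflag w z x y) :
    G.Connects A B C ∨ G.Flexible A B C z := by
  obtain ⟨hwx, hxy, hzy, -, -⟩ := hb
  obtain ⟨ho, han⟩ := h.out hw hwx
  obtain ⟨hzy, han'⟩ := extended_arrow_iff.1 hzy
  rcases ho.line_of_head han (extended_line_iff.1 hxy).1 with hc | ho
  · exact Or.inl hc
  · exact (ho.into_of_head_or_line (by simp) han' hzy).imp_right Or.inl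

theorem step (h : G.Flexible A B C w) (hw : w ∉ C) (hz : z ∉ C)
    (hwz : (G.extended (A ∪ B ∪ C)).augmented.Adj w z) :
    G.Connects A B C ∨ G.Flexible A B C z := by
  obtain ⟨-, hwz | ⟨y, ht⟩ | ⟨x, y, hb⟩⟩ := augmented_adj_iff.1 hwz
  · exact h.of_adj hw hz hwz
  · exact h.of_triplex hw hz ht
  · exact h.of_biflag hw hb

theorem connects_of_walk (h : G.Flexible A B C w) (hb : b ∈ B)
    (p : (G.extended (A ∪ B ∪ C)).augmented.Walk w b) (hp : ∀ c ∈ C, c ∉ p.support) :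
    G.Connects A B C := by
  induction p with
  | nil => exact h.connects hb
  | @cons w z b hwz p ih =>
    have hw : w ∉ C := fun hc => hp w hc (by simp)
    have hz : z ∉ C := fun hc => hp z hc (by simp)
    exact (h.step hw hz hwz).elim id fun h => ih h hb fun c hc hcp => hp c hc (by simp [hcp])

end Flexible

theorem connects_of_not_separates
    (h : ¬ Separates (G.extended (A ∪ B ∪ C)).augmented A B C) : G.Connects A B C := by
  unfold Separates at h
  push Not at h
  obtain ⟨a, ha, b, hb, p, hp⟩ := h
  exact Flexible.connects_of_walk (Or.inl (.start ha)) hb p hp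

/-- A walk of `U` from `w` to `B` avoids `C`. -/
def WalkTo (U : SimpleGraph V) (B C : Set V) (w : V) : Prop :=
  ∃ b ∈ B, ∃ p : U.Walk w b, ∀ c ∈ C, c ∉ p.support

theorem WalkTo.refl {U : SimpleGraph V} (hb : b ∈ B) (hbC : b ∉ C) : WalkTo U B C b :=
  ⟨b, hb, .nil, fun c hc hcb => hbC (by simpa [← List.mem_singleton.1 hcb] using hc)⟩

theorem WalkTo.cons {U : SimpleGraph V} (hz : WalkTo U B C z) (hw : w ∉ C)
    (h : w = z ∨ U.Adj w z) : WalkTo U B C w := by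
  rcases h with rfl | h
  · exact hz
  · obtain ⟨b, hb, p, hp⟩ := hz
    refine ⟨b, hb, .cons h p, fun c hc hcp => ?_⟩
    rcases List.mem_cons.1 (by simpa using hcp) with rfl | hcp
    · exact hw hc
    · exact hp c hc hcp

/-- A route that has arrived at `z` by a line continues to a vertex from which a walk of `U`
leads to `B` outside `C`. -/
def LineContinues (G : MixedGraph V) (U : SimpleGraph V) (B C : Set V) (z : V) : Prop :=
  WalkTo U B C z ∨ (z ∈ C ∧ ∃ w, G.Arrow w z ∧ WalkTo U B C w)

/-- A route that has arrived at `y` with the given mark continues to a vertex from which a walk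
of the augmented graph of `G.extended S` leads to `B` outside `C`. -/
def Continues (G : MixedGraph V) (S B C : Set V) (y : V) : Mark → Prop
  | .head => y ∈ G.ancestors S ∧ (WalkTo (G.extended S).augmented B C y ∨
      (y ∈ C ∧ ∃ z, G.Arrow z y ∧ WalkTo (G.extended S).augmented B C z) ∨
      (y ∈ C ∧ ∃ z, G.Line y z ∧ LineContinues G (G.extended S).augmented B C z))
  | .line => LineContinues G (G.extended S).augmented B C y
  | .tail => WalkTo (G.extended S).augmented B C y

theorem WalkTo.continues (h : WalkTo (G.extended S).augmented B C y)
    (hS : τ = .head → y ∈ G.ancestors S) : G.Continues S B C y τ := by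
  cases τ with
  | head => exact ⟨hS rfl, Or.inl h⟩
  | line => exact Or.inl h
  | tail => exact h

theorem OpenRoute.mem_ancestors (hA : A ⊆ S) (hC : C ⊆ S) (h : G.OpenRoute A C y τ)
    (hτ : τ = .tail) : y ∈ G.ancestors S := by
  induction h with
  | start ha => exact subset_ancestors (hA ha)
  | out => cases hτ
  | line => cases hτ
  | @into y z τ _ hzy hy ih =>
    refine hzy.mem_ancestors ?_
    by_cases hτ : τ = .tail
    · exact ih hτ
    · exact subset_ancestors (hC (hy.2 hτ))

theorem OpenRoute.mem_coherent (hA : A ⊆ S) (hC : C ⊆ S) (h : G.OpenRoute A C y τ)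
    (hτ : τ ≠ .head) : y ∈ G.coherent (G.ancestors S) := by
  induction h with
  | start ha => exact subset_coherent (subset_ancestors (hA ha))
  | out => exact absurd rfl hτ
  | @line y z τ _ hyz hy ih =>
    refine hyz.symm.mem_coherent ?_
    by_cases hτ : τ = .head
    · exact subset_coherent (subset_ancestors (hC (hy.2 hτ)))
    · exact ih hτ
  | into ho hzy hy => exact subset_coherent ((OpenRoute.into ho hzy hy).mem_ancestors hA hC rfl)

namespace Continues

theorem out (hG : G.IsChainGraph) (hC : C ⊆ S) (hyz : G.Arrow y z) (hy : y ∉ C)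
    (h : G.Continues S B C z .head) : G.Continues S B C y τ := by
  obtain ⟨hz, h⟩ := h
  have hyz' := extended_arrow_iff.2 ⟨hyz, hz⟩
  refine WalkTo.continues ?_ fun _ => hyz.mem_ancestors hz
  rcases h with hw | ⟨-, w, hwz, hw⟩ | ⟨-, u, hzu, hu | ⟨huC, w, hwu, hw⟩⟩
  · exact hw.cons hy (Or.inr hyz'.adj.augmented)
  · have hwz' := extended_arrow_iff.2 ⟨hwz, hz⟩
    exact hw.cons hy (eq_or_augmented_adj hyz'.1 hwz'.1 (Or.inl hyz'))
  · have hzu' := extended_line_iff.2 ⟨hzu, subset_coherent hz⟩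
    exact hu.cons hy (eq_or_augmented_adj hyz'.1 hzu'.2 (Or.inl hyz'))
  · have hzu' := extended_line_iff.2 ⟨hzu, subset_coherent hz⟩
    have hwu' := extended_arrow_iff.2 ⟨hwu, subset_ancestors (hC huC)⟩
    exact hw.cons hy (hG.eq_or_extended_augmented_adj hyz' hzu' hwu')

theorem line (hA : A ⊆ S) (hC : C ⊆ S) (ho : G.OpenRoute A C y τ) (hyz : G.Line y z)
    (hy : y ∈ C ↔ τ = .head) (h : G.Continues S B C z .line) : G.Continues S B C y τ := by
  by_cases hyC : y ∈ C
  · obtain rfl := hy.1 hyC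
    exact ⟨subset_ancestors (hC hyC), Or.inr (Or.inr ⟨hyC, z, hyz, h⟩)⟩
  have hτ : τ ≠ .head := mt hy.2 hyC
  have hyz' := extended_line_iff.2 ⟨hyz, ho.mem_coherent hA hC hτ⟩
  refine WalkTo.continues ?_ fun h => absurd h hτ
  rcases h with hz | ⟨hzC, w, hwz, hw⟩
  · exact hz.cons hyC (Or.inr hyz'.adj.augmented)
  · have hwz' := extended_arrow_iff.2 ⟨hwz, subset_ancestors (hC hzC)⟩
    exact hw.cons hyC (eq_or_augmented_adj hyz'.1 hwz'.1 (Or.inr hwz'))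

theorem into (hA : A ⊆ S) (hC : C ⊆ S) (ho : G.OpenRoute A C y τ) (hzy : G.Arrow z y)
    (hy : y ∈ C ↔ τ ≠ .tail) (h : G.Continues S B C z .tail) : G.Continues S B C y τ := by
  cases τ with
  | head =>
    have hyC := hy.2 (by simp)
    exact ⟨subset_ancestors (hC hyC), Or.inr (Or.inl ⟨hyC, z, hzy, h⟩)⟩
  | line => exact Or.inr ⟨hy.2 (by simp), z, hzy, h⟩
  | tail =>
    have hzy' := extended_arrow_iff.2 ⟨hzy, ho.mem_ancestors hA hC rfl⟩
    exact WalkTo.cons h (by simpa using hy) (Or.inr hzy'.adj.augmented.symm)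

theorem exists_walkTo (hG : G.IsChainGraph) (hA : A ⊆ S) (hC : C ⊆ S)
    (ho : G.OpenRoute A C y τ) (h : G.Continues S B C y τ) :
    ∃ a ∈ A, WalkTo (G.extended S).augmented B C a := by
  induction ho with
  | @start a ha => exact ⟨a, ha, h⟩
  | out _ hyz hy ih => exact ih (h.out hG hC hyz hy)
  | line ho hyz hy ih => exact ih (h.line hA hC ho hyz hy)
  | into ho hzy hy ih => exact ih (h.into hA hC ho hzy hy)

end Continues

theorem IsChainGraph.separates_iff (hG : G.IsChainGraph) (hBC : Disjoint B C) :
    Separates (G.extended (A ∪ B ∪ C)).augmented A B C ↔ ¬ G.Connects A B C := by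
  refine ⟨?_, fun h => by_contra fun hs => h (connects_of_not_separates hs)⟩
  rintro hs ⟨b, hb, τ, ho⟩
  have hbS : b ∈ G.ancestors (A ∪ B ∪ C) := subset_ancestors (Or.inl (Or.inr hb))
  have walk : WalkTo (G.extended (A ∪ B ∪ C)).augmented B C b :=
    .refl hb (Set.disjoint_left.1 hBC hb)
  obtain ⟨a, ha, b', hb', p, hp⟩ := Continues.exists_walkTo hG
    (Set.subset_union_left.trans Set.subset_union_left) Set.subset_union_right ho
    (walk.continues fun _ => hbS)
  obtain ⟨c, hc, hcp⟩ := hs a ha b' hb' p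
  exact hp c hc hcp

theorem TriplexEquiv.markovEquiv [Finite V] (hG : G.IsChainGraph) (hH : H.IsChainGraph)
    (h : TriplexEquiv G H) : MarkovEquiv G H := by
  intro X _ _
  have routeEquiv : RouteEquiv G H := routeEquiv_of_mem (G₀ := H) ⟨hG, h⟩ ⟨hH, .refl H⟩
  ext P
  refine forall_congr' fun A => forall_congr' fun B => forall_congr' fun C =>
    imp_congr_right fun _ => imp_congr_right fun _ => imp_congr_right fun hBC => ?_
  rw [hG.separates_iff hBC, hH.separates_iff hBC, routeEquiv A B C hBC]

/-! ### Separating nonadjacent vertices -/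

theorem Separates.symm {U : SimpleGraph V} (h : Separates U A B C) : Separates U B A C := by
  intro b hb a ha p
  obtain ⟨c, hc, hcp⟩ := h a ha b hb p.reverse
  exact ⟨c, hc, by simpa using hcp⟩

theorem IsChainGraph.connects_comm (hG : G.IsChainGraph) (hAC : Disjoint A C)
    (hBC : Disjoint B C) : G.Connects A B C ↔ G.Connects B A C := by
  rw [← not_iff_not, ← hG.separates_iff hBC, ← hG.separates_iff hAC, Set.union_comm B A]
  exact ⟨Separates.symm, Separates.symm⟩

theorem IsChainGraph.reach_or_arrow_of_openRoute (hG : G.IsChainGraph)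
    (ho : G.OpenRoute {c} {p | G.Arrow p c} y τ) :
    (G.Reach c y ∧ (τ = .tail → y = c)) ∨ (G.Arrow y c ∧ τ = .tail) := by
  induction ho with
  | start ha =>
    obtain rfl := ha
    exact Or.inl ⟨.refl _, fun _ => rfl⟩
  | out _ hyz hy ih =>
    rcases ih with ⟨hcy, -⟩ | ⟨hyc, -⟩
    · exact Or.inl ⟨hcy.trans hyz.1.reach, by simp⟩
    · exact absurd hyc hy
  | line _ hyz hy ih =>
    rcases ih with ⟨hcy, -⟩ | ⟨hyc, rfl⟩
    · exact Or.inl ⟨hcy.trans hyz.1.reach, by simp⟩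
    · simpa using hy.1 hyc
  | into _ hzy hy ih =>
    rcases ih with ⟨hcy, hτ⟩ | ⟨hyc, rfl⟩
    · obtain rfl := hτ (by_contra fun hne => hG.not_reach (hy.2 hne) hcy)
      exact Or.inr ⟨hzy, rfl⟩
    · exact absurd rfl (hy.1 hyc)

theorem IsChainGraph.not_connects_parents (hG : G.IsChainGraph) (hca : ¬ G.Reach c a)
    (hac : ¬ G.Arrow a c) : ¬ G.Connects {c} {a} {p | G.Arrow p c} := by
  rintro ⟨_, rfl, τ, ho⟩
  rcases hG.reach_or_arrow_of_openRoute ho with h | h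
  · exact hca h.1
  · exact hac h.1

theorem IsChainGraph.openRoute_ant_cases (hG : G.IsChainGraph) (hac : G.Reach a c)
    (hadj : ¬ G.Adj a c) (ho : G.OpenRoute {a} (G.ant a \ {a, c}) y τ) :
    (y = a ∧ τ = .tail) ∨ (y ∉ G.ant a ∧ τ = .head) ∨
      (y ∈ G.ant a \ {a, c} ∧ τ ≠ .head ∧ (τ = .line → G.Reach a y)) := by
  have mem_of_arrow : ∀ {y z}, G.Arrow z y → G.Reach y a → G.Reach a y →
      z ∈ G.ant a \ {a, c} := by
    refine fun hzy hya hay => ⟨hzy.1.reach.trans hya, ?_⟩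
    rintro (rfl | rfl)
    · exact hG.not_reach hzy hya
    · exact hG.not_reach hzy (hya.trans hac)
  induction ho with
  | start ha => exact Or.inl ⟨ha, rfl⟩
  | out _ hyz hy ih =>
    rcases ih with ⟨rfl, rfl⟩ | ⟨hya, rfl⟩ | ⟨hyC, -⟩
    · exact Or.inr (Or.inl ⟨hG.not_reach hyz, rfl⟩)
    · exact Or.inr (Or.inl ⟨fun hza => hya (hyz.1.reach.trans hza), rfl⟩)
    · exact absurd hyC hy
  | line _ hyz hy ih =>
    rcases ih with ⟨rfl, rfl⟩ | ⟨hya, rfl⟩ | ⟨hyC, hτ, -⟩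
    · refine Or.inr (Or.inr ⟨⟨hyz.2.reach, ?_⟩, by simp, fun _ => hyz.1.reach⟩)
      rintro (rfl | rfl)
      · exact G.irrefl _ hyz.1
      · exact hadj hyz.adj
    · exact absurd (hy.2 rfl).1 hya
    · exact absurd (hy.1 hyC) hτ
  | @into y z τ _ hzy hy ih =>
    rcases ih with ⟨rfl, rfl⟩ | ⟨hya, rfl⟩ | ⟨hyC, hhead, hay⟩
    · exact Or.inr (Or.inr ⟨mem_of_arrow hzy (.refl _) (.refl _), by simp, by simp⟩)
    · exact absurd (hy.2 (by simp)).1 hya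
    · have htail := hy.1 hyC
      have hline : τ = .line := by cases τ <;> trivial
      have hay := hay hline
      exact Or.inr (Or.inr ⟨mem_of_arrow hzy hyC.1 hay, by simp, by simp⟩)

theorem IsChainGraph.not_connects_ant (hG : G.IsChainGraph) (hac : G.Reach a c)
    (hca : G.Reach c a) (hne : a ≠ c) (hadj : ¬ G.Adj a c) :
    ¬ G.Connects {a} {c} (G.ant a \ {a, c}) := by
  rintro ⟨_, rfl, τ, ho⟩
  rcases hG.openRoute_ant_cases hac hadj ho with ⟨rfl, -⟩ | ⟨hn, -⟩ | ⟨hmem, -⟩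
  · exact hne rfl
  · exact hn hca
  · exact hmem.2 (by simp)

theorem IsChainGraph.exists_not_connects (hG : G.IsChainGraph) (hne : a ≠ c)
    (hadj : ¬ G.Adj a c) : ∃ C : Set V, a ∉ C ∧ c ∉ C ∧ (∀ b, G.Triplex a b c → b ∉ C) ∧
      ¬ G.Connects {a} {c} C := by
  by_cases hac : G.Reach a c
  · by_cases hca : G.Reach c a
    · refine ⟨G.ant a \ {a, c}, by simp, by simp, fun b ht hb => ?_,
        hG.not_connects_ant hac hca hne hadj⟩
      exact ht.arrow.elim (hG.not_reach · hb.1) (hG.not_reach · (hb.1.trans hac))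
    · have ha : a ∉ {p | G.Arrow p c} := fun h => hadj h.adj
      have hc : c ∉ {p | G.Arrow p c} := fun h => G.irrefl c h.1
      refine ⟨_, ha, hc, fun b ht h => h.2 ht.edge_right, ?_⟩
      rw [hG.connects_comm (by simpa using ha) (by simpa using hc)]
      exact hG.not_connects_parents hca fun h => hadj h.adj
  · exact ⟨{p | G.Arrow p a}, fun h => G.irrefl a h.1, fun h => hadj h.adj.symm,
      fun b ht h => h.2 ht.edge_left, hG.not_connects_parents hac fun h => hadj h.adj.symm⟩

/-! ### Two-point distributions -/

section TwoPoint

open scoped Classical in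
/-- The outcome of coins indexed by `V` in which exactly the coins in `S` show `true`. -/
noncomputable def boolIndicator (S : Set V) : V → Bool := fun v => decide (v ∈ S)

/-- The law of coins indexed by `V` of which those in `S` all show the result of one fair toss, and
the others are constant. -/
noncomputable def twoPointMeasure (S : Set V) : Measure (V → Bool) :=
  (1 / 2 : ENNReal) • Measure.dirac (boolIndicator ∅) +
    (1 / 2 : ENNReal) • Measure.dirac (boolIndicator S)

instance (S : Set V) : IsProbabilityMeasure (twoPointMeasure S) := by
  constructor
  simp [twoPointMeasure, ENNReal.inv_two_add_inv_two]

/-- `twoPointMeasure S` as a probability distribution. -/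
noncomputable def twoPoint (S : Set V) : ProbabilityMeasure (V → Bool) :=
  ⟨twoPointMeasure S, inferInstance⟩

/-- The σ-algebra generated by the coins in `C`. -/
abbrev coinAlgebra (C : Set V) : MeasurableSpace (V → Bool) :=
  MeasurableSpace.comap (C.domRestrict (π := fun _ : V => Bool)) inferInstance

theorem domRestrict_boolIndicator_of_disjoint (h : Disjoint A S) :
    A.domRestrict (boolIndicator S) = A.domRestrict (boolIndicator ∅) := by
  funext v
  simp [boolIndicator, Set.disjoint_left.1 h v.2]

variable [Finite V]

theorem ae_twoPointMeasure_iff {p : (V → Bool) → Prop} :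
    (∀ᵐ x ∂twoPointMeasure S, p x) ↔ p (boolIndicator ∅) ∧ p (boolIndicator S) := by
  rw [twoPointMeasure, ae_add_measure_iff, Measure.ae_ennreal_smul_measure_iff (by simp),
    Measure.ae_ennreal_smul_measure_iff (by simp), ae_dirac_eq, ae_dirac_eq]
  exact Iff.rfl

theorem integral_twoPointMeasure (f : (V → Bool) → ℝ) :
    ∫ x, f x ∂twoPointMeasure S = (f (boolIndicator ∅) + f (boolIndicator S)) / 2 := by
  rw [twoPointMeasure, integral_add_measure (Integrable.of_finite.smul_measure (by simp))
      (Integrable.of_finite.smul_measure (by simp)),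
    integral_smul_measure, integral_smul_measure, integral_dirac, integral_dirac]
  simp only [one_div, ENNReal.toReal_inv, ENNReal.toReal_ofNat, smul_eq_mul]
  ring

theorem condIndepCoord_twoPoint_of_disjoint (h : Disjoint A S) :
    CondIndepCoord (twoPoint S) A B C :=
  condIndepFun_of_ae_eq_measurable_left (Set.measurable_restrict A) (Set.measurable_restrict B)
    (measurable_const (a := A.domRestrict (boolIndicator ∅)))
    (ae_twoPointMeasure_iff.2 ⟨rfl, domRestrict_boolIndicator_of_disjoint h⟩)

/-- One coin of `C ∩ S` determines all coins of `S`. -/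
theorem condIndepCoord_twoPoint_of_mem (hcC : c ∈ C) (hcS : c ∈ S) :
    CondIndepCoord (twoPoint S) A B C := by
  classical
  let copy (y : C → Bool) (v : A) : Bool := if (v : V) ∈ S then y ⟨c, hcC⟩ else false
  have measurable_copy : Measurable[coinAlgebra C] fun x : V → Bool => copy (C.domRestrict x) :=
    (measurable_of_finite copy).comp (comap_measurable _)
  refine condIndepFun_of_ae_eq_measurable_left (Set.measurable_restrict A)
    (Set.measurable_restrict B) measurable_copy (ae_twoPointMeasure_iff.2 ⟨?_, ?_⟩)
  · funext v
    simp [copy, boolIndicator]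
  · funext v
    by_cases hv : (v : V) ∈ S <;> simp [copy, boolIndicator, hv, hcS]

theorem condExp_twoPointMeasure (hCS : Disjoint C S) {W : Set (V → Bool)}
    (hW : boolIndicator ∅ ∉ W) (hW' : boolIndicator S ∈ W) :
    ((twoPointMeasure S)⟦W | coinAlgebra C⟧) (boolIndicator ∅) = 1 / 2 := by
  set F := (twoPointMeasure S)⟦W | coinAlgebra C⟧
  have integral_eq : ∫ x, F x ∂twoPointMeasure S =
      ∫ x, W.indicator (fun _ => (1 : ℝ)) x ∂twoPointMeasure S :=
    integral_condExp (Set.measurable_restrict C).comap_le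
  have apply_eq : F (boolIndicator S) = F (boolIndicator ∅) :=
    stronglyMeasurable_condExp.measurable.factorsThrough
      (domRestrict_boolIndicator_of_disjoint hCS)
  rw [integral_twoPointMeasure, integral_twoPointMeasure, apply_eq,
    Set.indicator_of_notMem hW, Set.indicator_of_mem hW'] at integral_eq
  linarith

theorem not_condIndepCoord_twoPoint (haA : a ∈ A) (haS : a ∈ S) (hbB : b ∈ B) (hbS : b ∈ S)
    (hCS : Disjoint C S) : ¬ CondIndepCoord (twoPoint S) A B C := by
  intro h
  have condExp_mul := (condIndepFun_iff_condExp_inter_preimage_eq_mul (Set.measurable_restrict A)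
    (Set.measurable_restrict B)).1 h {y | y ⟨a, haA⟩ = true} {y | y ⟨b, hbB⟩ = true}
    (Set.toFinite _).measurableSet (Set.toFinite _).measurableSet
  have condExp_mul_apply := (ae_twoPointMeasure_iff.1 condExp_mul).1
  simp only [twoPoint, ProbabilityMeasure.coe_mk] at condExp_mul_apply
  rw [condExp_twoPointMeasure hCS (by simp [boolIndicator]) (by simp [boolIndicator, haS, hbS]),
    condExp_twoPointMeasure hCS (by simp [boolIndicator]) (by simp [boolIndicator, haS]),
    condExp_twoPointMeasure hCS (by simp [boolIndicator]) (by simp [boolIndicator, hbS])]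
    at condExp_mul_apply
  norm_num at condExp_mul_apply

theorem condIndepCoord_twoPoint_iff :
    CondIndepCoord (twoPoint S) A B C ↔ Disjoint A S ∨ Disjoint B S ∨ ¬ Disjoint C S := by
  constructor
  · intro h
    by_contra! hn
    obtain ⟨hA, hB, hC⟩ := hn
    obtain ⟨a, haA, haS⟩ := Set.not_disjoint_iff.1 hA
    obtain ⟨b, hbB, hbS⟩ := Set.not_disjoint_iff.1 hB
    exact not_condIndepCoord_twoPoint haA haS hbB hbS hC h
  · rintro (hA | hB | hC)
    · exact condIndepCoord_twoPoint_of_disjoint hA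
    · exact CondIndepFun.symm (condIndepCoord_twoPoint_of_disjoint hB)
    · obtain ⟨c, hcC, hcS⟩ := Set.not_disjoint_iff.1 hC
      exact condIndepCoord_twoPoint_of_mem hcC hcS

end TwoPoint

section MarkovEquiv

theorem OpenRoute.mono {A' : Set V} (hA : A ⊆ A') (h : G.OpenRoute A C y τ) :
    G.OpenRoute A' C y τ := by
  induction h with
  | start ha => exact .start (hA ha)
  | out _ hyz hy ih => exact .out ih hyz hy
  | line _ hyz hy ih => exact .line ih hyz hy
  | into _ hzy hy ih => exact .into ih hzy hy

theorem Connects.of_singleton (ha : a ∈ A) (hb : b ∈ B) (h : G.Connects {a} {b} C) :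
    G.Connects A B C := by
  obtain ⟨_, rfl, τ, ho⟩ := h
  exact ⟨_, hb, τ, ho.mono (Set.singleton_subset_iff.2 ha)⟩

theorem IsChainGraph.twoPoint_mem_ampModel_iff [Finite V] (hG : G.IsChainGraph) :
    twoPoint S ∈ G.ampModel (fun _ => Bool) ↔
      ∀ a ∈ S, ∀ b ∈ S, a ≠ b → ∀ C, Disjoint C S → G.Connects {a} {b} C := by
  constructor
  · intro h a ha b hb hne C hCS
    by_contra hn
    have haC : a ∉ C := Set.disjoint_right.1 hCS ha
    have hbC : b ∉ C := Set.disjoint_right.1 hCS hb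
    have indep := h {a} {b} C (by simpa) (by simpa) (by simpa)
      ((hG.separates_iff (by simpa)).2 hn)
    exact not_condIndepCoord_twoPoint (Set.mem_singleton a) ha (Set.mem_singleton b) hb hCS indep
  · intro h A B C hAB _ hBC hsep
    rw [hG.separates_iff hBC] at hsep
    rw [condIndepCoord_twoPoint_iff]
    by_contra! hn
    obtain ⟨hA, hB, hC⟩ := hn
    obtain ⟨a, haA, haS⟩ := Set.not_disjoint_iff.1 hA
    obtain ⟨b, hbB, hbS⟩ := Set.not_disjoint_iff.1 hB
    exact hsep ((h a haS b hbS (hAB.ne_of_mem haA hbB) C hC).of_singleton haA hbB)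

theorem OpenRoute.of_adj (hx : G.OpenRoute A C x .tail) (hxC : x ∉ C) (h : G.Adj x y) :
    (G.Arrow x y ∧ G.OpenRoute A C y .head) ∨ (G.Line x y ∧ G.OpenRoute A C y .line) ∨
      G.OpenRoute A C y .tail := by
  rcases adj_iff_arrow_or_line.1 h with h | h | h
  · exact Or.inl ⟨h, .out hx h hxC⟩
  · exact Or.inr (Or.inl ⟨h, .line hx h (by simp [hxC])⟩)
  · exact Or.inr (Or.inr (.into hx h (by simp [hxC])))

theorem OpenRoute.connects_of_adj (ho : G.OpenRoute A C a .tail) (ha : a ∉ C) (h : G.Adj a b) :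
    G.Connects A {b} C := by
  rcases ho.of_adj ha h with ⟨-, ho⟩ | ⟨-, ho⟩ | ho <;> exact ⟨b, rfl, _, ho⟩

theorem connects_of_adj (ha : a ∉ C) (h : G.Adj a b) : G.Connects {a} {b} C :=
  (OpenRoute.start (Set.mem_singleton a)).connects_of_adj ha h

theorem connects_of_not_triplex (ha : a ∉ C) (hb : b ∉ C) (hab : G.Adj a b) (hbc : G.Adj b c)
    (hne : a ≠ c) (hac : ¬ G.Adj a c) (ht : ¬ G.Triplex a b c) : G.Connects {a} {c} C := by
  have not_arrow : G.Edge a b → G.Edge c b → ¬ (G.Arrow a b ∨ G.Arrow c b) :=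
    fun hab hcb harrow => ht ⟨hne, hac, hab, hcb, harrow⟩
  rcases (OpenRoute.start (Set.mem_singleton a)).of_adj ha hab with ⟨hab, ho⟩ | ⟨hab, ho⟩ | ho
  · have hcb : ¬ G.Edge c b := fun hcb => not_arrow hab.1 hcb (Or.inl hab)
    exact ⟨c, rfl, _, .out ho ⟨hbc.resolve_right hcb, hcb⟩ hb⟩
  · rcases adj_iff_arrow_or_line.1 hbc with hbc | hbc | hcb
    · exact ⟨c, rfl, _, .out ho hbc hb⟩
    · exact ⟨c, rfl, _, .line ho hbc (by simp [hb])⟩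
    · exact absurd (Or.inr hcb) (not_arrow hab.1 hcb.1)
  · exact ho.connects_of_adj hb hbc

theorem adj_of_markovEquiv [Finite V] (hG : G.IsChainGraph) (hH : H.IsChainGraph)
    (h : MarkovEquiv G H) (hab : G.Adj a b) : H.Adj a b := by
  by_contra hn
  obtain ⟨C, haC, hbC, -, hsep⟩ := hH.exists_not_connects hab.ne hn
  have hP : twoPoint {a, b} ∈ G.ampModel (fun _ => Bool) := by
    rw [hG.twoPoint_mem_ampModel_iff]
    intro x hx y hy hne C hC
    refine connects_of_adj (Set.disjoint_right.1 hC hx) ?_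
    rcases hx with rfl | rfl <;> rcases hy with rfl | rfl
    · exact absurd rfl hne
    · exact hab
    · exact hab.symm
    · exact absurd rfl hne
  rw [h fun _ => Bool, hH.twoPoint_mem_ampModel_iff] at hP
  exact hsep (hP a (by simp) b (by simp) hab.ne C (by simp [haC, hbC]))

theorem triplex_of_markovEquiv [Finite V] (hG : G.IsChainGraph) (hH : H.IsChainGraph)
    (h : MarkovEquiv G H) (hs : SameSkeleton G H) (ht : G.Triplex a b c) : H.Triplex a b c := by
  by_contra hn
  obtain ⟨C, haC, hcC, hbC, hsep⟩ := hG.exists_not_connects ht.1 ht.not_adj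
  have hac : ¬ H.Adj a c := fun h => ht.not_adj ((hs a c).2 h)
  have hab : H.Adj a b := (hs a b).1 (Or.inl ht.edge_left)
  have hcb : H.Adj c b := (hs c b).1 (Or.inl ht.edge_right)
  have hP : twoPoint {a, b, c} ∈ H.ampModel (fun _ => Bool) := by
    rw [hH.twoPoint_mem_ampModel_iff]
    intro x hx y hy hne C hC
    have hxC := Set.disjoint_right.1 hC hx
    have hb : b ∉ C := Set.disjoint_right.1 hC (by simp)
    rcases hx with rfl | rfl | rfl <;> rcases hy with rfl | rfl | rfl
    · exact absurd rfl hne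
    · exact connects_of_adj hxC hab
    · exact connects_of_not_triplex hxC hb hab hcb.symm hne hac hn
    · exact connects_of_adj hxC hab.symm
    · exact absurd rfl hne
    · exact connects_of_adj hxC hcb.symm
    · exact connects_of_not_triplex hxC hb hcb hab.symm hne (mt Adj.symm hac) (mt Triplex.symm hn)
    · exact connects_of_adj hxC hcb
    · exact absurd rfl hne
  rw [← h fun _ => Bool, hG.twoPoint_mem_ampModel_iff] at hP
  exact hsep (hP a (by simp) c (by simp) ht.1 C (by simp [haC, hbC b ht, hcC]))

variable [Finite V]

theorem MarkovEquiv.symm (h : MarkovEquiv G H) : MarkovEquiv H G :=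
  fun X _ _ => (h X).symm

theorem MarkovEquiv.trans (h : MarkovEquiv G H) (h' : MarkovEquiv H K) :
    MarkovEquiv G K :=
  fun X _ _ => (h X).trans (h' X)

theorem markovEquiv_iff_triplexEquiv (hG : G.IsChainGraph) (hH : H.IsChainGraph) :
    MarkovEquiv G H ↔ TriplexEquiv G H := by
  refine ⟨fun h => ?_, TriplexEquiv.markovEquiv hG hH⟩
  have hs : SameSkeleton G H := fun a b =>
    ⟨adj_of_markovEquiv hG hH h, adj_of_markovEquiv hH hG h.symm⟩
  exact ⟨hs, ⟨triplex_of_markovEquiv hG hH h hs,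
    triplex_of_markovEquiv hH hG h.symm fun a b => (hs a b).symm⟩⟩

theorem setOf_markovEquiv_eq_triplexClass (hG₀ : G₀.IsChainGraph) :
    {G | G.IsChainGraph ∧ MarkovEquiv G G₀} = triplexClass G₀ :=
  Set.ext fun _ => and_congr_right fun hG => markovEquiv_iff_triplexEquiv hG hG₀

namespace IsMarkovClass

variable {𝒢 𝒢₁ 𝒢₂ : Set (MixedGraph V)}

theorem isChainGraph (h : IsMarkovClass 𝒢) (hG : G ∈ 𝒢) : G.IsChainGraph := by
  obtain ⟨G₀, -, rfl⟩ := h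
  exact hG.1

theorem markovEquiv (h : IsMarkovClass 𝒢) (hG : G ∈ 𝒢) (hH : H ∈ 𝒢) : MarkovEquiv G H := by
  obtain ⟨G₀, -, rfl⟩ := h
  exact hG.2.trans hH.2.symm

theorem eq_of_mem (h₁ : IsMarkovClass 𝒢₁) (h₂ : IsMarkovClass 𝒢₂) (hG₁ : G ∈ 𝒢₁)
    (hG₂ : G ∈ 𝒢₂) : 𝒢₁ = 𝒢₂ := by
  obtain ⟨H₁, -, rfl⟩ := h₁
  obtain ⟨H₂, -, rfl⟩ := h₂
  have hequiv := hG₁.2.symm.trans hG₂.2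
  exact Set.ext fun _ => and_congr_right fun _ => ⟨(·.trans hequiv), (·.trans hequiv.symm)⟩

theorem essentialGraph_mem (h : IsMarkovClass 𝒢) : essentialGraph 𝒢 ∈ 𝒢 := by
  obtain ⟨G₀, hG₀, rfl⟩ := h
  rw [setOf_markovEquiv_eq_triplexClass hG₀]
  exact MixedGraph.essentialGraph_mem ⟨hG₀, .refl G₀⟩

end IsMarkovClass

end MarkovEquiv

end MixedGraph

theorem theorem3p2 {V : Type*} [Finite V] :
    (∀ 𝒢 : Set (MixedGraph V), MixedGraph.IsMarkovClass 𝒢 →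
      (∀ G ∈ 𝒢, MixedGraph.SameSkeleton (MixedGraph.essentialGraph 𝒢) G) ∧
      (MixedGraph.essentialGraph 𝒢).IsChainGraph ∧
      MixedGraph.essentialGraph 𝒢 ∈ 𝒢 ∧
      ∀ G ∈ 𝒢, MixedGraph.MarkovEquiv (MixedGraph.essentialGraph 𝒢) G) ∧
    ∀ 𝒢₁ 𝒢₂ : Set (MixedGraph V), MixedGraph.IsMarkovClass 𝒢₁ → MixedGraph.IsMarkovClass 𝒢₂ →
      (𝒢₁ = 𝒢₂ ↔ MixedGraph.essentialGraph 𝒢₁ = MixedGraph.essentialGraph 𝒢₂) := by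
  refine ⟨fun 𝒢 h𝒢 => ?_, fun 𝒢₁ 𝒢₂ h₁ h₂ => ⟨congrArg _, fun h => ?_⟩⟩
  · have hmem := h𝒢.essentialGraph_mem
    have hchain := h𝒢.isChainGraph hmem
    have hequiv := fun G (hG : G ∈ 𝒢) => h𝒢.markovEquiv hmem hG
    exact ⟨fun G hG => ((MixedGraph.markovEquiv_iff_triplexEquiv hchain
      (h𝒢.isChainGraph hG)).1 (hequiv G hG)).sameSkeleton, hchain, hmem, hequiv⟩
  · exact h₁.eq_of_mem h₂ h₁.essentialGraph_mem (h ▸ h₂.essentialGraph_mem)
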